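/- **Model.** Let $n\ge d\ge 1$, $\delta\in(0,1/2)$ and $\theta\in\mathbf R^d$ with $\|\theta\|^2\le 1$. One observes $Y_i=\eta_i\theta+\xi_i$, $i=1,\dots,n$, where $\eta_1$ is a Rademacher variable, $(\eta_i)$ is the homogeneous symmetric Markov chain on $\{-1,1\}$ with flip probability $\delta$ (that is, $\eta_{i+1}=-\eta_i$ with probability $\delta$ and $\eta_{i+1}=\eta_i$ with probability $1-\delta$), and $\xi_1,\dots,\xi_n$ are i.i.d., independent of $(\eta_i)$, isotropic ($\mathbf E\,\xi_i\xi_i^\top=\mathbf I_d$) and $1$-sub-Gaussian ($\mathbf E e^{\langle v,\xi_i\rangle}\le e^{\|v\|^2/2}$ for all $v\in\mathbf R^d$). The loss is $\ell(a,b)=\min\{\|a-b\|,\|a+b\|\}$. **Estimators.** For $1\le \ell\le n$ put $k=\lfloor n/\ell\rfloor$ and split the first $k\ell$ observations into $\ell$ consecutive buckets of length $k$ (so all observations are used when $n=k\ell$). Let $\tilde Y\in\mathbf R^{d\times\ell}$ be the matrix whose columns are the bucket means, let $\hat\Sigma=\frac1\ell\tilde Y\tilde Y^\top$, and let $$\tilde\theta(\ell)=\sqrt{\left(\lambda_{\max}(\hat\Sigma)-\tfrac1k\right)_+}\;v_{\max}(\hat\Sigma),$$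 where $\lambda_{\max}(\hat\Sigma)$ is the largest eigenvalue and $v_{\max}(\hat\Sigma)$ is any corresponding unit eigenvector, chosen as an arbitrary function of $\ell$ and the data. Let $g_i=2^id$ for $i=0,\dots,M$, where $M$ is the greatest integer with $2^Md\le n$. For a constant $C>0$ let $\tilde m$ be the smallest $m\in\{0,\dots,M\}$ such that $$\ell^2(\tilde\theta(g_k),\tilde\theta(g_{k-1}))\le 4C^2\left(\frac{\sqrt{dg_k}}{n}\wedge\frac{dg_k}{n^2\|\tilde\theta(g_k)\|^2}\right)\qquad\text{for all } m+1\le k\le M$$ (the second term of the minimum being $+\infty$ if $\tilde\theta(g_k)=0$), and let $\tilde\ell=g_{\tilde m}=2^{\tilde m}d$. The estimator $\tilde\theta(\tilde\ell)$ depends on the data and on $C$, but not on $\delta$ or $\theta$. **Theorem.** There are absolute constants $C_0,c_0,c_1>0$ such that for every $C\ge C_0$ there is a constant $K>0$ depending only on $C$ such that, for all $n,d,\delta,\theta$ and all laws of the noise as above, $$\ell^2(\tilde\theta(\tilde\ell),\theta)\le K\left(\sqrt{\frac{\delta d}{n}}+\frac dn\right)$$ with probability at least $1-c_1\log(n/d)\,e^{-c_0d}$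 if $d<n$, and with probability at least $1-c_1e^{-c_0d}$ if $d=n$. -/

import Mathlib

open MeasureTheory ProbabilityTheory

namespace BinaryHMM

noncomputable section

/-- Euclidean space `ℝ^d`. -/
abbrev E (d : ℕ) : Type := EuclideanSpace ℝ (Fin d)

/-! ### The model -/

/-- `η` is the homogeneous binary symmetric Markov chain of length `n` with flip probability `δ`,
started from a Rademacher variable: the probability of each path `s ∈ {-1, 1}^n` is `1/2` times
the product of the transition probabilities along it. -/
structure IsSymmetricSignChain {Ω : Type*} [MeasurableSpace Ω] (μ : Measure Ω) {n : ℕ} (δ : ℝ)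
    (η : Fin n → Ω → ℝ) : Prop where
  measurable : ∀ i, Measurable (η i)
  path_prob : ∀ s : Fin n → ℝ, (∀ i, s i = 1 ∨ s i = -1) →
    μ {ω | ∀ i, η i ω = s i} = ENNReal.ofReal
      (1 / 2 * ∏ i : Fin n,
        if h : (i : ℕ) + 1 < n then (if s ⟨i + 1, h⟩ = s i then 1 - δ else δ) else 1)

/-- `ξ` is an i.i.d. family of isotropic `1`-sub-Gaussian random vectors of `ℝ^d`. -/
structure IsIsotropicSubGaussianNoise {Ω : Type*} [MeasurableSpace Ω] (μ : Measure Ω) {n d : ℕ}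
    (ξ : Fin n → Ω → E d) : Prop where
  measurable : ∀ i, Measurable (ξ i)
  indep : iIndepFun ξ μ
  identDistrib : ∀ i j, IdentDistrib (ξ i) (ξ j) μ μ
  subGaussian : ∀ i (v : E d), HasSubgaussianMGF (fun ω => inner ℝ v (ξ i ω)) (‖v‖₊ ^ 2) μ
  isotropic : ∀ i (u v : E d), ∫ ω, inner ℝ u (ξ i ω) * inner ℝ v (ξ i ω) ∂μ = inner ℝ u v

/-- The observations `Y_i = η_i θ + ξ_i`. -/
def observations {Ω : Type*} {n d : ℕ} (θ : E d) (η : Fin n → Ω → ℝ) (ξ : Fin n → Ω → E d)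
    (ω : Ω) : Fin n → E d :=
  fun i => η i ω • θ + ξ i ω

/-- The loss `min (‖a - b‖, ‖a + b‖)`. -/
def loss {d : ℕ} (a b : E d) : ℝ := min ‖a - b‖ ‖a + b‖

/-! ### The bucketed spectral estimator -/

/-- The mean of the data in bucket `i`, where `ℓ` consecutive buckets of length `k = ⌊n / ℓ⌋` are
used: bucket `i` is `{i k, …, i k + k - 1}` (indices from `0`), and the last `n - k ℓ` observations
are not used. -/
def bucketMean {n d : ℕ} (ℓ : ℕ) (y : Fin n → E d) (i : Fin ℓ) : E d :=
  ((n / ℓ : ℕ) : ℝ)⁻¹ • ∑ j ∈ Finset.univ.filter (fun j : Fin n => (j : ℕ) / (n / ℓ) = (i : ℕ)), y j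

/-- The `d × ℓ` matrix whose columns are the bucket means. -/
def bucketMatrix {n d : ℕ} (ℓ : ℕ) (y : Fin n → E d) : Matrix (Fin d) (Fin ℓ) ℝ :=
  Matrix.of fun a i => bucketMean ℓ y i a

/-- The Gram matrix of the bucket means, divided by `ℓ`. -/
def sampleCov {n d : ℕ} (ℓ : ℕ) (y : Fin n → E d) : Matrix (Fin d) (Fin d) ℝ :=
  (ℓ : ℝ)⁻¹ • (bucketMatrix ℓ y * (bucketMatrix ℓ y).transpose)

/-- The largest (real) eigenvalue. -/
def lambdaMax {d : ℕ} (A : Matrix (Fin d) (Fin d) ℝ) : ℝ := sSup (spectrum ℝ A)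

/-- `v` is a unit eigenvector for the largest eigenvalue of `A`. -/
def IsTopUnitEigenvector {d : ℕ} (A : Matrix (Fin d) (Fin d) ℝ) (v : E d) : Prop :=
  ‖v‖ = 1 ∧ Matrix.toEuclideanLin A v = lambdaMax A • v

/-- A choice of `v_max` for the sample covariances: to the number of buckets and the data, it
assigns a top unit eigenvector (which is determined at best up to its sign). -/
def IsTopEigenvectorRule {n d : ℕ} (v : ℕ → (Fin n → E d) → E d) : Prop :=
  ∀ (ℓ : ℕ) (y : Fin n → E d), IsTopUnitEigenvector (sampleCov ℓ y) (v ℓ y)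

/-- The spectral estimator with `ℓ` buckets (of length `k = ⌊n / ℓ⌋`),
`√((λ_max(Σ̂) - 1/k)₊) · v_max(Σ̂)`. -/
def thetaTilde {n d : ℕ} (v : ℕ → (Fin n → E d) → E d) (ℓ : ℕ) (y : Fin n → E d) : E d :=
  √(max (lambdaMax (sampleCov ℓ y) - 1 / ((n / ℓ : ℕ) : ℝ)) 0) • v ℓ y

/-! ### The adaptive number of buckets -/

/-- The dyadic grid points `g_i = 2^i d`. -/
def grid (d i : ℕ) : ℕ := 2 ^ i * d

/-- The greatest `M` with `2^M d ≤ n` (for `1 ≤ d ≤ n`, such an `M` is at most `n`). -/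
def gridTop (n d : ℕ) : ℕ := Nat.findGreatest (fun i => grid d i ≤ n) n

/-- The squared threshold `4 C² (√(d g) / n ∧ d g / (n² ‖t‖²))`, where the second quantity is
`+∞` for `t = 0`. -/
def threshold {d : ℕ} (C : ℝ) (n g : ℕ) (t : E d) : ℝ :=
  open Classical in
  4 * C ^ 2 * (if t = 0 then √(d * g) / n
    else min (√(d * g) / n) (d * g / ((n : ℝ) ^ 2 * ‖t‖ ^ 2)))

/-- The index `m̃`: the smallest `m ∈ {0, …, M}` such that all comparisons of consecutive grid
points above `m` stay below the threshold (`m = M` is always admissible). -/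
def mTilde {n d : ℕ} (v : ℕ → (Fin n → E d) → E d) (C : ℝ) (y : Fin n → E d) : ℕ :=
  sInf {m | m ≤ gridTop n d ∧ ∀ k, m + 1 ≤ k → k ≤ gridTop n d →
    loss (thetaTilde v (grid d k) y) (thetaTilde v (grid d (k - 1)) y) ^ 2 ≤
      threshold C n (grid d k) (thetaTilde v (grid d k) y)}

/-- The adaptive number of buckets `2^m̃ d`. -/
def ellTilde {n d : ℕ} (v : ℕ → (Fin n → E d) → E d) (C : ℝ) (y : Fin n → E d) : ℕ :=
  grid d (mTilde v C y)

/-- The fully adaptive estimator, a function of the data (and of the tuning constant `C`). -/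
def adaptiveEstimator {n d : ℕ} (v : ℕ → (Fin n → E d) → E d) (C : ℝ) (y : Fin n → E d) : E d :=
  thetaTilde v (ellTilde v C y) y

end

end BinaryHMM

/-!
For a grid point `g` with buckets of length `k = ⌊n / g⌋`, write `a_i` for the bucket means of the
signs and `Z_i` for the bucket sums of the noise. The matrix `Σ̂ - I / k - θ θᵀ` equals
`g⁻¹ (-(∑ (1 - a_i²)) θ θᵀ + k⁻¹ (θ Wᵀ + W θᵀ) + k⁻² ∑ (Z_i Z_iᵀ - k I))` with `W = ∑ a_i Z_i`
(`sampleCov_sub_rankOne`): a bias, a cross term and a pure noise term. Three facts control them.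

* `∑ (1 - a_i²)` is at most the number of sign flips of the chain, which is at most `2 δ n + d`
  outside an event of probability `e^{-d}`, by its explicit generating function
  (`measure_not_signs_or_flips_gt_le`). There is no bias at all when `k = 1`.
* `‖W‖ ≤ 6 √(d n)` outside an event of probability `e^{-d}`: given the signs, `W` is sub-Gaussian
  (`measure_cross_noise_le`).
* `‖∑ (Z_i Z_iᵀ - k I)‖ ≤ 832 k √(d g)` outside an event of probability `e^{-d}`, by a Bernstein
  bound for products of sub-Gaussian variables and a `1/2`-net (`measure_quadratic_noise_le`).

Let `ν_g = √(d g) / n`. On the intersection of these events over all grid points, the error matrix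
has norm at most `1703 ν_g` for all `g` from some oracle grid point on, namely as soon as
`‖θ‖⁴ δ'² n⁴ ≤ d g³` and `n ‖θ‖² ≤ 2 g`, where `δ' = max δ (d / n)`, or `g` is the last grid point.
Eigenvalue and eigenvector perturbation then bound the squared loss of the estimator at `g` by a
multiple of `min (ν_g, ν_g² / ‖θ‖²)` (`loss_sq_le_of_nearly_rankOne`). The thresholds of the
adaptive rule are empirical versions of this quantity, so every comparison above the oracle passes,
the selected grid point is at most the oracle one, and the comparisons passed in between add up
geometrically to a bound of the same order at the selected point (`lepski`). Finally the minimality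
of the oracle grid point turns `min (ν, ν² / ‖θ‖²)` into `√(δ' d / n)` (`rate_of_oracle`), which
is at most `√(δ d / n) + d / n`.
-/

namespace BinaryHMM

open scoped ENNReal NNReal

/-! ### The spectral estimator under perturbation of a rank-one matrix -/

lemma sampleCov_apply {n d : ℕ} (ℓ : ℕ) (y : Fin n → E d) (x : E d) :
    Matrix.toEuclideanLin (sampleCov ℓ y) x =
      (ℓ : ℝ)⁻¹ • ∑ i : Fin ℓ, inner ℝ (bucketMean ℓ y i) x • bucketMean ℓ y i := by
  ext a
  simp only [sampleCov, Matrix.toEuclideanLin, Matrix.toLpLin_apply, Matrix.smul_mulVec,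
    ← Matrix.mulVec_mulVec, PiLp.smul_apply, WithLp.ofLp_sum, Finset.sum_apply, Pi.smul_apply,
    WithLp.ofLp_smul, smul_eq_mul]
  congr 1
  simp only [Matrix.mulVec, dotProduct, bucketMatrix, Matrix.transpose_apply, Matrix.of_apply,
    PiLp.inner_apply]
  refine Finset.sum_congr rfl fun i _ => ?_
  rw [mul_comm]
  congr 1
  refine Finset.sum_congr rfl fun j _ => ?_
  simp [mul_comm]

lemma isHermitian_sampleCov {n d : ℕ} (ℓ : ℕ) (y : Fin n → E d) :
    (sampleCov ℓ y).IsHermitian := by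
  simp [Matrix.IsHermitian, sampleCov, Matrix.conjTranspose_eq_transpose_of_trivial,
    Matrix.transpose_mul]

lemma inner_toEuclideanLin_le_lambdaMax {d : ℕ} {A : Matrix (Fin d) (Fin d) ℝ}
    (hA : A.IsHermitian) (x : E d) :
    inner ℝ x (Matrix.toEuclideanLin A x) ≤ lambdaMax A * ‖x‖ ^ 2 := by
  have hfin : (spectrum ℝ A).Finite := by
    rw [hA.spectrum_real_eq_range_eigenvalues]; exact Set.finite_range _
  have hpos : (lambdaMax A • (1 : Matrix (Fin d) (Fin d) ℝ) - A).PosSemidef := by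
    rw [Matrix.posSemidef_iff_isHermitian_and_spectrum_nonneg]
    refine ⟨(Matrix.isHermitian_one.smul (k := lambdaMax A) (IsSelfAdjoint.all _)).sub hA, ?_⟩
    intro a ha
    rw [← Algebra.algebraMap_eq_smul_one, ← spectrum.singleton_sub_eq] at ha
    obtain ⟨x, hx, rfl⟩ : ∃ x ∈ spectrum ℝ A, lambdaMax A - x = a := by simpa using ha
    exact sub_nonneg.2 (le_csSup hfin.bddAbove hx)
  have := hpos.dotProduct_mulVec_nonneg x.ofLp
  have e1 : inner ℝ x (Matrix.toEuclideanLin A x) = x.ofLp ⬝ᵥ (A.mulVec x.ofLp) := by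
    rw [Matrix.toEuclideanLin, Matrix.toLpLin_apply]
    simp [PiLp.inner_apply, dotProduct, mul_comm]
  have e2 : ‖x‖ ^ 2 = x.ofLp ⬝ᵥ x.ofLp := by
    rw [EuclideanSpace.norm_sq_eq]; simp [dotProduct, sq]
  rw [e1, e2]
  simp [Matrix.sub_mulVec, Matrix.smul_mulVec, dotProduct_sub] at this
  linarith

lemma loss_nonneg {d : ℕ} (a b : E d) : 0 ≤ loss a b := le_min (norm_nonneg _) (norm_nonneg _)

lemma loss_comm {d : ℕ} (a b : E d) : loss a b = loss b a := by
  simp [loss, norm_sub_rev a b, add_comm a b]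

lemma loss_neg_right {d : ℕ} (a b : E d) : loss a (-b) = loss a b := by
  simp [loss, min_comm, ← sub_eq_add_neg]

lemma loss_neg_left {d : ℕ} (a b : E d) : loss (-a) b = loss a b := by
  rw [loss_comm, loss_neg_right, loss_comm]

lemma loss_triangle {d : ℕ} (a b c : E d) : loss a c ≤ loss a b + loss b c := by
  have key : ∀ a b c : E d, loss a b = ‖a - b‖ → loss b c = ‖b - c‖ →
      loss a c ≤ loss a b + loss b c := fun a b c h1 h2 => by
    rw [h1, h2]; exact (min_le_left _ _).trans (norm_sub_le_norm_sub_add_norm_sub a b c)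
  have sgn : ∀ a b : E d, loss a b = ‖a - b‖ ∨ loss (-a) b = ‖-a - b‖ := fun a b => by
    rcases min_choice ‖a - b‖ ‖a + b‖ with h | h
    · exact Or.inl h
    · right; rw [loss_neg_left, loss, h, ← norm_neg]; congr 1; abel
  have sgn' : ∀ a b : E d, loss a b = ‖a - b‖ ∨ loss a (-b) = ‖a - -b‖ := fun a b => by
    rcases min_choice ‖a - b‖ ‖a + b‖ with h | h
    · exact Or.inl h
    · right; rw [loss_neg_right, loss, h, sub_neg_eq_add]
  rcases sgn a b with h1 | h1 <;> rcases sgn' b c with h2 | h2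
  · exact key _ _ _ h1 h2
  · simpa [loss_neg_right, loss_neg_left] using key _ _ _ h1 h2
  · simpa [loss_neg_right, loss_neg_left] using key _ _ _ h1 h2
  · simpa [loss_neg_right, loss_neg_left] using key _ _ _ h1 h2

lemma norm_le_norm_add_loss {d : ℕ} (a b : E d) : ‖a‖ ≤ ‖b‖ + loss a b := by
  rcases min_choice ‖a - b‖ ‖a + b‖ with h | h <;> rw [loss, h]
  · exact norm_le_norm_add_norm_sub' a b
  · have := norm_sub_le (a + b) b
    rw [add_sub_cancel_right] at this; linarith

/-- If `T - κ` is within `ε` of `θ θᵀ` and `u` is a unit eigenvector for the top eigenvalue `lam` of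
`T`, then `√(lam - κ)₊ u` estimates `θ` up to sign with squared loss of order
`min (ε, ε² / ‖θ‖²)`. The first bound needs only the Rayleigh quotients; the second one also uses
that the component of `θ` orthogonal to `u` is small, as the error applied to `u` contains it. -/
lemma loss_sq_le_of_nearly_rankOne {d : ℕ} {T : E d → E d} {θ u : E d} {lam κ ε : ℝ}
    (hu : ‖u‖ = 1) (hTu : T u = lam • u) (hray : ∀ x, inner ℝ x (T x) ≤ lam * ‖x‖ ^ 2)
    (hε : ∀ x, ‖T x - κ • x - inner ℝ θ x • θ‖ ≤ ε * ‖x‖) :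
    loss (√(max (lam - κ) 0) • u) θ ^ 2 ≤ 3 * ε ∧
      loss (√(max (lam - κ) 0) • u) θ ^ 2 * ‖θ‖ ^ 2 ≤ 12 * ε ^ 2 := by
  have hε0 : 0 ≤ ε := by
    have := (norm_nonneg _).trans (hε u)
    rwa [hu, mul_one] at this
  -- The sign of `θ` is free, so `⟪u, θ⟫ ≥ 0` may be assumed.
  wlog hs0 : 0 ≤ inner ℝ u θ generalizing θ
  · have := this (θ := -θ) (fun x => by simpa using hε x) (by
      rw [inner_neg_right]; linarith)
    simpa [loss_neg_right] using this
  set s : ℝ := inner ℝ u θ with hs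
  set t : ℝ := ‖θ‖ with ht
  have huu : inner ℝ u u = (1 : ℝ) := by rw [real_inner_self_eq_norm_sq, hu]; norm_num
  have hst : s ≤ t := by
    have := real_inner_le_norm u θ; rwa [hu, one_mul] at this
  have hquad : ∀ x : E d, |inner ℝ x (T x) - κ * ‖x‖ ^ 2 - (inner ℝ x θ) ^ 2| ≤ ε * ‖x‖ ^ 2 := by
    intro x
    have h1 : inner ℝ x (T x) - κ * ‖x‖ ^ 2 - (inner ℝ x θ) ^ 2 =
        inner ℝ x (T x - κ • x - inner ℝ θ x • θ) := by
      rw [inner_sub_right, inner_sub_right, inner_smul_right, inner_smul_right,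
        real_inner_self_eq_norm_sq, real_inner_comm x θ]; ring
    rw [h1]
    refine (abs_real_inner_le_norm _ _).trans ?_
    have := mul_le_mul_of_nonneg_left (hε x) (norm_nonneg x)
    nlinarith
  have hlam1 : |lam - κ - s ^ 2| ≤ ε := by
    have := hquad u
    rw [hTu, inner_smul_right, huu, hu] at this
    simpa using this
  obtain ⟨hl1, hl2⟩ := abs_le.1 hlam1
  have hlam2 : t ^ 2 - ε ≤ lam - κ := by
    rcases eq_or_ne θ 0 with h0 | h0
    · have : t = 0 := by rw [ht, h0, norm_zero]
      rw [this]
      nlinarith [sq_nonneg s]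
    · have htp : 0 < t := norm_pos_iff.2 h0
      have h1 := hray θ
      have h2 := (abs_le.1 (hquad θ)).1
      rw [real_inner_self_eq_norm_sq, ← ht] at h2
      rw [← ht] at h1
      have : (t ^ 2 - ε - (lam - κ)) * t ^ 2 ≤ 0 := by nlinarith
      have := nonpos_of_mul_nonpos_left this (by positivity)
      linarith
  have hpos2 : t ^ 2 - s ^ 2 ≤ 2 * ε := by linarith
  have hs2 : s ^ 2 ≤ t ^ 2 := by gcongr
  -- `a` is the norm of the estimator.
  set a : ℝ := √(max (lam - κ) 0) with ha
  have ha0 : 0 ≤ a := Real.sqrt_nonneg _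
  have hasq : a ^ 2 = max (lam - κ) 0 := Real.sq_sqrt (le_max_right _ _)
  have has : |a ^ 2 - s ^ 2| ≤ ε := by
    rw [hasq, abs_le]
    constructor
    · linarith [le_max_left (lam - κ) 0]
    · rcases max_choice (lam - κ) 0 with h | h <;> rw [h]
      · linarith
      · nlinarith [sq_nonneg s]
  have hdecomp : loss (a • u) θ ^ 2 ≤ (a - s) ^ 2 + (t ^ 2 - s ^ 2) := by
    have : loss (a • u) θ ^ 2 ≤ ‖a • u - θ‖ ^ 2 := by
      gcongr
      · exact loss_nonneg _ _
      · exact min_le_left _ _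
    refine this.trans (le_of_eq ?_)
    rw [norm_sub_sq_real, norm_smul, hu, inner_smul_left, ← hs, ← ht]
    simp only [Real.norm_eq_abs, conj_trivial, mul_one, sq_abs]
    ring
  have hfac : |a - s| * (a + s) ≤ ε := by
    have : a ^ 2 - s ^ 2 = (a - s) * (a + s) := by ring
    rwa [this, abs_mul, abs_of_nonneg (a := a + s) (by linarith)] at has
  have hle : |a - s| ≤ a + s := by
    rw [abs_le]; constructor <;> linarith
  have h1 : (a - s) ^ 2 ≤ ε := by
    rw [← sq_abs]; nlinarith [abs_nonneg (a - s)]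
  have hA : loss (a • u) θ ^ 2 ≤ 3 * ε := by linarith
  refine ⟨hA, ?_⟩
  by_cases hcase : t ^ 2 ≤ 4 * ε
  · calc loss (a • u) θ ^ 2 * t ^ 2 ≤ (3 * ε) * (4 * ε) := by gcongr
      _ = 12 * ε ^ 2 := by ring
  push Not at hcase
  -- The component of `T u - κ u - s θ` orthogonal to `u` is that of `- s θ`.
  have horth : s ^ 2 * (t ^ 2 - s ^ 2) ≤ ε ^ 2 := by
    have h2 := hε u
    rw [hTu, hu, mul_one, real_inner_comm, ← hs] at h2
    have h3 : ‖lam • u - κ • u - s • θ‖ ^ 2 =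
        (lam - κ - s ^ 2) ^ 2 + s ^ 2 * (t ^ 2 - s ^ 2) := by
      rw [← sub_smul, norm_sub_sq_real, norm_smul, norm_smul, hu, inner_smul_left, inner_smul_right,
        ← hs, ← ht]
      simp only [Real.norm_eq_abs, conj_trivial, mul_one, sq_abs, mul_pow]
      ring
    have h4 : ‖lam • u - κ • u - s • θ‖ ^ 2 ≤ ε ^ 2 := by gcongr
    nlinarith [sq_nonneg (lam - κ - s ^ 2)]
  have hs_half : t ^ 2 / 2 ≤ s ^ 2 := by linarith
  have h5 : (a - s) ^ 2 * s ^ 2 ≤ ε ^ 2 := by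
    have : |a - s| * s ≤ ε := le_trans (by gcongr; linarith) hfac
    calc (a - s) ^ 2 * s ^ 2 = (|a - s| * s) ^ 2 := by rw [mul_pow, sq_abs]
      _ ≤ ε ^ 2 := by gcongr
  have h6 : loss (a • u) θ ^ 2 * t ^ 2 ≤ ((a - s) ^ 2 + (t ^ 2 - s ^ 2)) * (2 * s ^ 2) := by
    gcongr
    linarith
  nlinarith [sq_nonneg ε]

/-! ### Selection of the grid point -/

/-- The comparison of the adaptive rule as two inequalities free of the division by `‖u‖²`, the
case `u = 0` included. -/
lemma sq_le_threshold_iff {d n g : ℕ} {C x : ℝ} {u : E d} :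
    x ^ 2 ≤ threshold C n g u ↔
      x ^ 2 ≤ 4 * C ^ 2 * (√(d * g) / n) ∧ x ^ 2 * ‖u‖ ^ 2 ≤ 4 * C ^ 2 * (√(d * g) / n) ^ 2 := by
  have hC : 0 ≤ 4 * C ^ 2 := by positivity
  unfold threshold
  split_ifs with h
  · subst h
    simp only [norm_zero]
    constructor
    · intro hx
      exact ⟨hx, by rw [zero_pow two_ne_zero, mul_zero]; positivity⟩
    · exact fun hx => hx.1
  · have hu : 0 < ‖u‖ ^ 2 := by have := norm_pos_iff.2 h; positivity
    rw [mul_min_of_nonneg _ _ hC, le_min_iff, div_pow, Real.sq_sqrt (by positivity)]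
    have : 4 * C ^ 2 * (d * g / ((n : ℝ) ^ 2 * ‖u‖ ^ 2)) =
        4 * C ^ 2 * (d * g / (n : ℝ) ^ 2) / ‖u‖ ^ 2 := by
      rw [← div_div]; ring
    rw [this, le_div_iff₀ hu]

lemma loss_self {d : ℕ} (a : E d) : loss a a = 0 := by
  simp [loss]

/-- Steps bounded by a sequence growing at least by the factor `7 / 6` add up to at most `7` times
the bound of the last step, since `∑ (6 / 7)^j = 7`. -/
lemma loss_telescope {d : ℕ} {f : ℕ → E d} {σ : ℕ → ℝ} {c : ℝ} {m p : ℕ} (hmp : m ≤ p)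
    (hc : 0 ≤ c) (hσ : ∀ k, 0 ≤ σ k) (hgeom : ∀ k, 7 * σ k ≤ 6 * σ (k + 1))
    (hstep : ∀ k, m + 1 ≤ k → k ≤ p → loss (f k) (f (k - 1)) ≤ c * σ k) :
    loss (f m) (f p) ≤ 7 * c * σ p := by
  induction p, hmp using Nat.le_induction with
  | base => rw [loss_self]; have := hσ m; positivity
  | succ p hp ih =>
    have h1 := ih fun k h1 h2 => hstep k h1 (by omega)
    have h2 := hstep (p + 1) (by omega) le_rfl
    rw [Nat.add_sub_cancel] at h2
    have h3 := loss_triangle (f m) (f p) (f (p + 1))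
    rw [loss_comm (f p)] at h3
    have := mul_le_mul_of_nonneg_left (hgeom p) hc
    nlinarith

/-- Adaptive selection. If the estimators `f i` with `m₀ ≤ i ≤ M` have squared loss at most
`B² min (ν i, ν i² / ‖θ‖²)`, then so does, up to the constant, the selected one at level `ν m₀`. -/
lemma lepski {d : ℕ} {f : ℕ → E d} {θ : E d} {ν : ℕ → ℝ} {B C : ℝ} {m₀ M : ℕ} (hm₀ : m₀ ≤ M)
    (hB : 0 ≤ B) (hC : B + B ^ 2 ≤ C) (hν : ∀ k, 0 ≤ ν k) (hgeom : ∀ k, ν (k + 1) = √2 * ν k)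
    (hf : ∀ i, m₀ ≤ i → i ≤ M → loss (f i) θ ^ 2 ≤ B ^ 2 * ν i ∧
      loss (f i) θ ^ 2 * ‖θ‖ ^ 2 ≤ B ^ 2 * ν i ^ 2) :
    let m := sInf {m | m ≤ M ∧ ∀ k, m + 1 ≤ k → k ≤ M →
      loss (f k) (f (k - 1)) ^ 2 ≤ 4 * C ^ 2 * ν k ∧
      loss (f k) (f (k - 1)) ^ 2 * ‖f k‖ ^ 2 ≤ 4 * C ^ 2 * ν k ^ 2}
    loss (f m) θ ^ 2 ≤ ((B + 28 * C) ^ 2 + 4 * (B + 14 * C) ^ 4) * ν m₀ ∧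
      loss (f m) θ ^ 2 * ‖θ‖ ^ 2 ≤ ((B + 28 * C) ^ 2 + 4 * (B + 14 * C) ^ 4) * ν m₀ ^ 2 := by
  intro m
  have hC0 : 0 ≤ C := le_trans (by positivity) hC
  have hBC : B ≤ C := le_trans (by nlinarith) hC
  -- The same hypotheses and comparisons, with square roots taken.
  have sq1 : ∀ {x y c : ℝ}, 0 ≤ x → 0 ≤ y → 0 ≤ c → (x ^ 2 ≤ c ^ 2 * y ↔ x ≤ c * √y) := by
    intro x y c hx hy hc
    rw [← Real.sqrt_le_sqrt_iff (by positivity), Real.sqrt_sq hx, Real.sqrt_mul (by positivity),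
      Real.sqrt_sq hc]
  have sq2 : ∀ {x s y c : ℝ}, 0 ≤ x → 0 ≤ s → 0 ≤ y → 0 ≤ c →
      (x ^ 2 * s ^ 2 ≤ c ^ 2 * y ^ 2 ↔ x * s ≤ c * y) := by
    intro x s y c hx hs hy hc
    rw [← mul_pow, ← mul_pow, sq_le_sq₀ (by positivity) (by positivity)]
  have h4 : 4 * C ^ 2 = (2 * C) ^ 2 := by ring
  have hσ : ∀ k, 0 ≤ √(ν k) := fun k => Real.sqrt_nonneg _
  have hσν : ∀ k, √(ν k) * √(ν k) = ν k := fun k => Real.mul_self_sqrt (hν k)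
  -- Noise levels grow by `√2` and their square roots by `2 ^ (1 / 4)`; both exceed `7 / 6`.
  have hsqrt2 : (7 / 6 : ℝ) ^ 2 ≤ √2 := Real.le_sqrt_of_sq_le (by norm_num)
  have hg1 : ∀ k, 7 * ν k ≤ 6 * ν (k + 1) := fun k => by
    rw [hgeom]; nlinarith [hν k]
  have hg2 : ∀ k, 7 * √(ν k) ≤ 6 * √(ν (k + 1)) := fun k => by
    have : 7 / 6 * √(ν k) ≤ √(ν (k + 1)) := by
      apply Real.le_sqrt_of_sq_le
      rw [mul_pow, Real.sq_sqrt (hν k), hgeom]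
      exact mul_le_mul_of_nonneg_right hsqrt2 (hν k)
    linarith
  have hmono : Monotone ν := monotone_nat_of_le_succ fun k => by nlinarith [hg1 k, hν k]
  have hfa : ∀ i, m₀ ≤ i → i ≤ M → loss (f i) θ ≤ B * √(ν i) := fun i h1 h2 =>
    (sq1 (loss_nonneg _ _) (hν i) hB).1 (hf i h1 h2).1
  have hfb : ∀ i, m₀ ≤ i → i ≤ M → loss (f i) θ * ‖θ‖ ≤ B * ν i := fun i h1 h2 =>
    (sq2 (loss_nonneg _ _) (norm_nonneg _) (hν i) hB).1 (hf i h1 h2).2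
  -- All comparisons above `m₀` pass, so that the selected index is at most `m₀`.
  have hmem : m₀ ∈ {m | m ≤ M ∧ ∀ k, m + 1 ≤ k → k ≤ M →
      loss (f k) (f (k - 1)) ^ 2 ≤ 4 * C ^ 2 * ν k ∧
      loss (f k) (f (k - 1)) ^ 2 * ‖f k‖ ^ 2 ≤ 4 * C ^ 2 * ν k ^ 2} := by
    refine ⟨hm₀, fun k hk hkM => ?_⟩
    have hlt : ν (k - 1) ≤ ν k := hmono (by omega)
    have ha : loss (f (k - 1)) θ ≤ B * √(ν k) :=
      (hfa (k - 1) (by omega) (by omega)).trans (by gcongr)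
    have hb : loss (f (k - 1)) θ * ‖θ‖ ≤ B * ν k :=
      (hfb (k - 1) (by omega) (by omega)).trans (by gcongr)
    have ha' := hfa k (by omega) hkM
    have hb' := hfb k (by omega) hkM
    have htri : loss (f k) (f (k - 1)) ≤ loss (f k) θ + loss (f (k - 1)) θ := by
      have := loss_triangle (f k) θ (f (k - 1)); rwa [loss_comm θ] at this
    have hsum : loss (f k) (f (k - 1)) ≤ 2 * B * √(ν k) := by linarith
    rw [h4, sq1 (loss_nonneg _ _) (hν k) (by positivity),
      sq2 (loss_nonneg _ _) (norm_nonneg _) (hν k) (by positivity)]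
    constructor
    · refine hsum.trans ?_
      gcongr
    · calc loss (f k) (f (k - 1)) * ‖f k‖
          ≤ loss (f k) (f (k - 1)) * (‖θ‖ + B * √(ν k)) := by
            gcongr
            · exact loss_nonneg _ _
            · exact (norm_le_norm_add_loss _ _).trans (by linarith)
        _ ≤ (loss (f k) θ + loss (f (k - 1)) θ) * ‖θ‖ + 2 * B * √(ν k) * (B * √(ν k)) := by
            rw [mul_add]
            gcongr
        _ ≤ 2 * (B + B ^ 2) * ν k := by
            have : 2 * B * √(ν k) * (B * √(ν k)) = 2 * B ^ 2 * ν k := by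
              linear_combination 2 * B ^ 2 * hσν k
            rw [this, add_mul]; linarith
        _ ≤ 2 * C * ν k := by gcongr; exact hν k
  have hmm₀ : m ≤ m₀ := Nat.sInf_le hmem
  obtain ⟨-, hcmp⟩ := Nat.sInf_mem ⟨m₀, hmem⟩
  have hc1 : ∀ k, m + 1 ≤ k → k ≤ m₀ → loss (f k) (f (k - 1)) ≤ 2 * C * √(ν k) := by
    intro k h1 h2
    have := (hcmp k h1 (h2.trans hm₀)).1
    rwa [h4, sq1 (loss_nonneg _ _) (hν k) (by positivity)] at this
  have hc2 : ∀ k, m + 1 ≤ k → k ≤ m₀ → loss (f k) (f (k - 1)) * ‖f k‖ ≤ 2 * C * ν k := by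
    intro k h1 h2
    have := (hcmp k h1 (h2.trans hm₀)).2
    rwa [h4, sq2 (loss_nonneg _ _) (norm_nonneg _) (hν k) (by positivity)] at this
  have hall : ∀ p, m ≤ p → p ≤ m₀ → loss (f p) θ ≤ (B + 14 * C) * √(ν m₀) := by
    intro p h1 h2
    have := loss_telescope h2 (by positivity) hσ hg2 fun k h3 h4 => hc1 k (by omega) h4
    have h5 := loss_triangle (f p) (f m₀) θ
    have h6 := hfa m₀ le_rfl hm₀
    linarith
  have hm := hall m le_rfl hmm₀
  have hl0 : 0 ≤ loss (f m) θ := loss_nonneg _ _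
  have hG1 : (B + 14 * C) ^ 2 ≤ (B + 28 * C) ^ 2 := by gcongr; linarith
  have hG4 : 0 ≤ (B + 14 * C) ^ 4 := by positivity
  constructor
  · have h1 := (sq1 hl0 (hν m₀) (by positivity)).2 hm
    refine h1.trans ?_
    gcongr
    · exact hν m₀
    · linarith
  · rcases le_or_gt ‖θ‖ (2 * (B + 14 * C) * √(ν m₀)) with hsmall | hlarge
    · have h1 : loss (f m) θ * ‖θ‖ ≤ 2 * (B + 14 * C) ^ 2 * ν m₀ := by
        calc loss (f m) θ * ‖θ‖
            ≤ ((B + 14 * C) * √(ν m₀)) * (2 * (B + 14 * C) * √(ν m₀)) := by gcongr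
          _ = 2 * (B + 14 * C) ^ 2 * (√(ν m₀) * √(ν m₀)) := by ring
          _ = _ := by rw [hσν]
      refine ((sq2 hl0 (norm_nonneg _) (hν m₀) (by positivity)).2 h1).trans ?_
      gcongr
      nlinarith [sq_nonneg (B + 28 * C)]
    · -- Here all estimators between `m` and `m₀` have norm at least `‖θ‖ / 2`.
      have hnorm : ∀ p, m ≤ p → p ≤ m₀ → ‖θ‖ / 2 ≤ ‖f p‖ := by
        intro p h1 h2
        have := norm_le_norm_add_loss θ (f p)
        rw [loss_comm] at this
        have := hall p h1 h2
        linarith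
      have hθ : 0 < ‖θ‖ := lt_of_le_of_lt (by positivity) hlarge
      have hstep : ∀ k, m + 1 ≤ k → k ≤ m₀ →
          loss (f k) (f (k - 1)) ≤ 4 * C / ‖θ‖ * ν k := by
        intro k h1 h2
        have h3 := hc2 k h1 h2
        have h4 := mul_le_mul_of_nonneg_left (hnorm k (by omega) h2)
          (loss_nonneg (f k) (f (k - 1)))
        rw [div_mul_eq_mul_div, le_div_iff₀ hθ]
        linarith
      have h5 := loss_telescope hmm₀ (by positivity) hν hg1 hstep
      have h6 := loss_triangle (f m) (f m₀) θ
      have h7 := hfb m₀ le_rfl hm₀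
      have h8 : loss (f m) (f m₀) * ‖θ‖ ≤ 28 * C * ν m₀ := by
        have := mul_le_mul_of_nonneg_right h5 hθ.le
        have e : 7 * (4 * C / ‖θ‖) * ν m₀ * ‖θ‖ = 28 * C * ν m₀ := by field_simp; ring
        rwa [e] at this
      have h9 : loss (f m) θ * ‖θ‖ ≤ (B + 28 * C) * ν m₀ := by
        have := mul_le_mul_of_nonneg_right h6 hθ.le
        nlinarith
      refine ((sq2 hl0 (norm_nonneg _) (hν m₀) (by positivity)).2 h9).trans ?_
      gcongr
      linarith

/-! ### Sign changes of the symmetric chain -/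

/-- The number of sign changes between consecutive entries of `x`. -/
noncomputable def flips {n : ℕ} (x : Fin n → ℝ) : ℕ :=
  open Classical in
  (Finset.univ.filter fun j : Fin n => ∃ h : (j : ℕ) + 1 < n, x ⟨j + 1, h⟩ ≠ x j).card

/-- The sign `±1` of a Boolean. -/
def boolSign (b : Bool) : ℝ := if b then 1 else -1

lemma boolSign_injective : Function.Injective boolSign := by
  intro a b h
  cases a <;> cases b <;> simp [boolSign] at h ⊢ <;> norm_num at h

lemma boolSign_eq (b : Bool) : boolSign b = 1 ∨ boolSign b = -1 := by
  cases b <;> simp [boolSign]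

/-- Summing out the first sign contributes the factor `p + q`, whatever the rest of the path. -/
lemma sum_prod_transitions (p q : ℝ) (m : ℕ) :
    ∑ s : Fin (m + 1) → Bool, ∏ i : Fin m, (if s i.succ = s i.castSucc then p else q) =
      2 * (p + q) ^ m := by
  induction m with
  | zero => simp
  | succ m ih =>
    rw [← (Fin.consEquiv fun _ => Bool).sum_comp, Fintype.sum_prod_type_right]
    have : ∀ s : Fin (m + 1) → Bool, ∑ a : Bool,
        ∏ i : Fin (m + 1), (if (Fin.consEquiv fun _ => Bool) (a, s) i.succ =
          (Fin.consEquiv fun _ => Bool) (a, s) i.castSucc then p else q) =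
        (p + q) * ∏ i : Fin m, (if s i.succ = s i.castSucc then p else q) := by
      intro s
      simp only [Fin.prod_univ_succ, Fin.consEquiv_apply, Fin.cons_succ, Fin.castSucc_zero,
        Fin.cons_zero, ← Fin.succ_castSucc, Fintype.sum_bool]
      rw [← add_mul]
      congr 1
      cases s 0 <;> simp [add_comm]
    simp only [this, ← Finset.mul_sum]
    have h2 := ih
    rw [h2]; ring

/-- Weighting a path by `r ^ flips` replaces the flip probability `δ` by `r * δ`. -/
lemma pathProb_mul_pow_flips (δ r : ℝ) {m : ℕ} (s : Fin (m + 1) → Bool) :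
    (∏ i : Fin (m + 1), if h : (i : ℕ) + 1 < m + 1 then
        (if boolSign (s ⟨i + 1, h⟩) = boolSign (s i) then 1 - δ else δ) else 1) *
      r ^ flips (fun i => boolSign (s i)) =
    ∏ i : Fin m, (if s i.succ = s i.castSucc then 1 - δ else r * δ) := by
  classical
  rw [flips, ← Finset.prod_const, Finset.prod_filter, ← Finset.prod_mul_distrib,
    Fin.prod_univ_castSucc]
  simp only [Fin.val_castSucc, Fin.val_last, lt_self_iff_false, dite_false, IsEmpty.exists_iff,
    if_false, mul_one]
  refine Finset.prod_congr rfl fun i _ => ?_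
  have hi : (i : ℕ) + 1 < m + 1 := by omega
  have e : (⟨i + 1, hi⟩ : Fin (m + 1)) = i.succ := rfl
  rw [dif_pos hi]
  simp only [hi, exists_true_left, e, boolSign_injective.eq_iff, ne_eq]
  split_ifs <;> simp_all [mul_comm]

/-- Outside an event of probability `e^{-a}` all `η i` are signs, with at most `2 δ n + a` flips.
The path probabilities sum to one, so it is enough to sum them over the exceptional sign paths. -/
lemma measure_not_signs_or_flips_gt_le {Ω : Type*} [MeasurableSpace Ω] {μ : Measure Ω}
    [IsProbabilityMeasure μ]
    {n : ℕ} {δ : ℝ} {η : Fin n → Ω → ℝ} (hη : IsSymmetricSignChain μ δ η) (hn : 1 ≤ n)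
    (hδ0 : 0 ≤ δ) (hδ1 : δ ≤ 1) (a : ℝ) :
    μ {ω | ¬ ((∀ i, η i ω = 1 ∨ η i ω = -1) ∧
      (flips (fun i => η i ω) : ℝ) ≤ 2 * δ * n + a)} ≤ ENNReal.ofReal (Real.exp (-a)) := by
  classical
  obtain ⟨m, rfl⟩ : ∃ m, n = m + 1 := ⟨n - 1, by omega⟩
  set W : (Fin (m + 1) → Bool) → ℝ := fun s => 1 / 2 * ∏ i : Fin (m + 1),
    if h : (i : ℕ) + 1 < m + 1 then
      (if boolSign (s ⟨i + 1, h⟩) = boolSign (s i) then 1 - δ else δ) else 1 with hW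
  have hW0 : ∀ s, 0 ≤ W s := fun s => by
    refine mul_nonneg (by norm_num) (Finset.prod_nonneg fun i _ => ?_)
    split_ifs <;> linarith
  have hgen : ∀ r : ℝ, ∑ s, W s * r ^ flips (fun i => boolSign (s i)) =
      (1 - δ + r * δ) ^ m := fun r => by
    simp only [hW, mul_assoc, pathProb_mul_pow_flips, ← Finset.mul_sum, sum_prod_transitions]
    ring
  have hsum : ∑ s, W s = 1 := by simpa using hgen 1
  set G : (Fin (m + 1) → Bool) → Set Ω := fun s => {ω | ∀ i, η i ω = boolSign (s i)} with hG
  have hGm : ∀ s, MeasurableSet (G s) := fun s => by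
    simp only [hG, Set.ofPred_forall]
    exact MeasurableSet.iInter fun i => hη.measurable i (measurableSet_singleton _)
  have hμG : ∀ s, μ.real (G s) = W s := fun s => by
    rw [measureReal_def, hη.path_prob _ fun i => boolSign_eq _, ENNReal.toReal_ofReal (hW0 s)]
  have hdisj : Pairwise (Function.onFun Disjoint G) := by
    intro s s' hne
    refine Set.disjoint_left.2 fun ω h1 h2 => hne (funext fun i => boolSign_injective ?_)
    rw [← h1 i, ← h2 i]
  set good : Finset (Fin (m + 1) → Bool) := Finset.univ.filter fun s =>
    (flips (fun i => boolSign (s i)) : ℝ) ≤ 2 * δ * (m + 1 : ℕ) + a with hgood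
  have hsub : {ω | ¬ ((∀ i, η i ω = 1 ∨ η i ω = -1) ∧
      (flips (fun i => η i ω) : ℝ) ≤ 2 * δ * (m + 1 : ℕ) + a)} ⊆ (⋃ s ∈ good, G s)ᶜ := by
    intro ω hω hmem
    simp only [Set.mem_iUnion] at hmem
    obtain ⟨s, hs, hsω⟩ := hmem
    refine hω ⟨fun i => ?_, ?_⟩
    · rw [hsω i]; exact boolSign_eq _
    · have : (fun i => η i ω) = fun i => boolSign (s i) := funext hsω
      rw [this]
      exact (Finset.mem_filter.1 hs).2
  refine (measure_mono hsub).trans ?_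
  rw [← ofReal_measureReal]
  refine ENNReal.ofReal_le_ofReal ?_
  rw [probReal_compl_eq_one_sub (Finset.measurableSet_biUnion _ fun s _ => hGm s),
    measureReal_biUnion_finset (fun s _ s' _ h => hdisj h) fun s _ => hGm s]
  simp only [hμG]
  have hsplit : ∑ s ∈ good, W s + ∑ s ∈ Finset.univ.filter (fun s =>
      ¬ (flips (fun i => boolSign (s i)) : ℝ) ≤ 2 * δ * (m + 1 : ℕ) + a), W s = 1 := by
    rw [← hsum, hgood, Finset.sum_filter_add_sum_filter_not]
  -- The generating function of the number of flips at `r = e`, and Markov's inequality.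
  have hbad : ∑ s ∈ Finset.univ.filter (fun s =>
      ¬ (flips (fun i => boolSign (s i)) : ℝ) ≤ 2 * δ * (m + 1 : ℕ) + a), W s ≤
      Real.exp (-(2 * δ * (m + 1 : ℕ) + a)) *
        ∑ s, W s * Real.exp 1 ^ flips (fun i => boolSign (s i)) := by
    rw [Finset.mul_sum]
    refine (Finset.sum_le_sum fun s hs => ?_).trans
      (Finset.sum_le_sum_of_subset_of_nonneg (Finset.subset_univ _) fun s _ _ => ?_)
    · have h := (Finset.mem_filter.1 hs).2
      push Not at h
      rw [← Real.exp_nat_mul, mul_one, mul_left_comm, ← Real.exp_add]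
      exact le_mul_of_one_le_right (hW0 s) (Real.one_le_exp (by linarith))
    · have := hW0 s
      positivity
  rw [hgen] at hbad
  have hexp : (1 - δ + Real.exp 1 * δ) ^ m ≤ Real.exp (2 * δ * (m + 1 : ℕ)) := by
    have he : Real.exp 1 ≤ 3 := Real.exp_one_lt_three.le
    have hpos := Real.exp_pos 1
    calc (1 - δ + Real.exp 1 * δ) ^ m ≤ (Real.exp (2 * δ)) ^ m := by
          have := mul_le_mul_of_nonneg_right he hδ0
          gcongr
          linarith [Real.add_one_le_exp (2 * δ)]
      _ = Real.exp (2 * δ * m) := by rw [← Real.exp_nat_mul]; ring_nf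
      _ ≤ _ := by
          gcongr
          · omega
  have : Real.exp (-(2 * δ * (m + 1 : ℕ) + a)) * (1 - δ + Real.exp 1 * δ) ^ m ≤
      Real.exp (-a) := by
    refine (mul_le_mul_of_nonneg_left hexp (Real.exp_pos _).le).trans_eq ?_
    rw [← Real.exp_add]; ring_nf
  linarith

/-! ### Means of the signs over buckets -/

/-- Bucket `i` for `ℓ` consecutive buckets of length `⌊n / ℓ⌋`. -/
def bucket (n : ℕ) {ℓ : ℕ} (i : Fin ℓ) : Finset (Fin n) :=
  Finset.univ.filter fun j : Fin n => (j : ℕ) / (n / ℓ) = (i : ℕ)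

lemma mem_bucket {n ℓ : ℕ} {i : Fin ℓ} {j : Fin n} :
    j ∈ bucket n i ↔ (j : ℕ) / (n / ℓ) = (i : ℕ) := by simp [bucket]

lemma disjoint_bucket (n : ℕ) {ℓ : ℕ} {i i' : Fin ℓ} (h : i ≠ i') :
    Disjoint (bucket n i) (bucket n i') := by
  rw [Finset.disjoint_left]
  intro j h1 h2
  rw [mem_bucket] at h1 h2
  exact h (Fin.ext (h1 ▸ h2))

lemma card_bucket {n ℓ : ℕ} (hk : 1 ≤ n / ℓ) (i : Fin ℓ) : (bucket n i).card = n / ℓ := by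
  have hle : ((i : ℕ) + 1) * (n / ℓ) ≤ n :=
    (Nat.mul_le_mul_right _ i.2).trans (Nat.mul_div_le n ℓ)
  have : (bucket n i).map Fin.valEmbedding =
      Finset.Ico ((i : ℕ) * (n / ℓ)) (((i : ℕ) + 1) * (n / ℓ)) := by
    ext j
    simp only [Finset.mem_map, mem_bucket, Fin.valEmbedding_apply, Finset.mem_Ico]
    constructor
    · rintro ⟨j, hj, rfl⟩
      rw [Nat.div_eq_iff (by omega)] at hj
      obtain ⟨h1, h2⟩ := hj
      rw [add_mul]
      omega
    · rintro ⟨h1, h2⟩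
      refine ⟨⟨j, by omega⟩, ?_, rfl⟩
      rw [Nat.div_eq_iff (by omega)]
      rw [add_mul] at h2
      dsimp only
      omega
  rw [← Finset.card_map, this, Nat.card_Ico, add_mul]
  omega

/-- The mean of the numbers `x` over bucket `i`. -/
noncomputable def signMean {n : ℕ} (ℓ : ℕ) (x : Fin n → ℝ) (i : Fin ℓ) : ℝ :=
  ((n / ℓ : ℕ) : ℝ)⁻¹ * ∑ j ∈ bucket n i, x j

lemma bucketMean_add_smul {n d : ℕ} (ℓ : ℕ) (x : Fin n → ℝ) (θ : E d) (ξ : Fin n → E d)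
    (i : Fin ℓ) :
    bucketMean ℓ (fun j => x j • θ + ξ j) i = signMean ℓ x i • θ + bucketMean ℓ ξ i := by
  simp only [bucketMean, signMean, bucket, Finset.sum_add_distrib, smul_add, ← Finset.sum_smul,
    smul_smul]

lemma signMean_sq_le_one {n ℓ : ℕ} (hk : 1 ≤ n / ℓ) {x : Fin n → ℝ}
    (hx : ∀ j, x j = 1 ∨ x j = -1) (i : Fin ℓ) : signMean ℓ x i ^ 2 ≤ 1 := by
  have hk' : (0 : ℝ) < (n / ℓ : ℕ) := by exact_mod_cast hk
  rw [sq_le_one_iff_abs_le_one, signMean, abs_mul, abs_inv, abs_of_pos hk', inv_mul_le_iff₀ hk',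
    mul_one]
  refine (Finset.abs_sum_le_sum_abs _ _).trans ?_
  rw [← card_bucket hk i, Finset.card_eq_sum_ones, Nat.cast_sum]
  refine Finset.sum_le_sum fun j _ => ?_
  rcases hx j with h | h <;> simp [h]

lemma signMean_of_const {n ℓ : ℕ} (hk : 1 ≤ n / ℓ) {x : Fin n → ℝ} {i : Fin ℓ} {a : ℝ}
    (h : ∀ j ∈ bucket n i, x j = a) : signMean ℓ x i = a := by
  have hk' : (0 : ℝ) < (n / ℓ : ℕ) := by exact_mod_cast hk
  rw [signMean, Finset.sum_congr rfl h, Finset.sum_const, card_bucket hk, nsmul_eq_mul]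
  field_simp

/-- A bucket without an inner flip has constant signs. -/
lemma signMean_sq_eq_one {n ℓ : ℕ} (hk : 1 ≤ n / ℓ) {x : Fin n → ℝ}
    (hx : ∀ j, x j = 1 ∨ x j = -1) {i : Fin ℓ}
    (h : ∀ j ∈ bucket n i, ∀ h : (j : ℕ) + 1 < n, (⟨j + 1, h⟩ : Fin n) ∈ bucket n i →
      x ⟨j + 1, h⟩ = x j) : signMean ℓ x i ^ 2 = 1 := by
  have hle : ((i : ℕ) + 1) * (n / ℓ) ≤ n :=
    (Nat.mul_le_mul_right _ i.2).trans (Nat.mul_div_le n ℓ)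
  rw [add_mul] at hle
  have hb : ∀ r (hr : r < n / ℓ), (⟨i * (n / ℓ) + r, by omega⟩ : Fin n) ∈ bucket n i := by
    intro r hr
    rw [mem_bucket, Nat.div_eq_iff (by omega)]
    dsimp only
    omega
  have hconst : ∀ r (hr : r < n / ℓ),
      x ⟨i * (n / ℓ) + r, by omega⟩ = x ⟨i * (n / ℓ), by omega⟩ := by
    intro r
    induction r with
    | zero => intro _; rfl
    | succ r ih =>
      intro hr
      rw [← ih (by omega)]
      exact h ⟨i * (n / ℓ) + r, by omega⟩ (hb r (by omega))
        (by dsimp only; omega) (hb (r + 1) hr)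
  rw [signMean_of_const (a := x ⟨i * (n / ℓ), by omega⟩) hk]
  · rcases hx ⟨i * (n / ℓ), by omega⟩ with h | h <;> simp [h]
  · intro j hj
    rw [mem_bucket, Nat.div_eq_iff (by omega)] at hj
    rw [← hconst (j - i * (n / ℓ)) (by omega)]
    congr 1
    ext
    dsimp only
    omega

lemma sum_one_sub_signMean_sq_le_flips {n ℓ : ℕ} (hk : 1 ≤ n / ℓ) {x : Fin n → ℝ}
    (hx : ∀ j, x j = 1 ∨ x j = -1) : ∑ i : Fin ℓ, (1 - signMean ℓ x i ^ 2) ≤ (flips x : ℝ) := by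
  classical
  have h1 : ∀ i : Fin ℓ, 1 - signMean ℓ x i ^ 2 ≤ ((Finset.univ.filter fun j : Fin n =>
      ∃ h : (j : ℕ) + 1 < n, x ⟨j + 1, h⟩ ≠ x j).filter (· ∈ bucket n i)).card := by
    intro i
    by_cases hc : (((Finset.univ.filter fun j : Fin n =>
      ∃ h : (j : ℕ) + 1 < n, x ⟨j + 1, h⟩ ≠ x j).filter (· ∈ bucket n i)).card) = 0
    · rw [hc, signMean_sq_eq_one hk hx]
      · simp
      · intro j hj h _
        by_contra hne
        rw [Finset.card_eq_zero] at hc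
        have : j ∈ ((Finset.univ.filter fun j : Fin n =>
          ∃ h : (j : ℕ) + 1 < n, x ⟨j + 1, h⟩ ≠ x j).filter (· ∈ bucket n i)) := by
          simp only [Finset.mem_filter, Finset.mem_univ, true_and]
          exact ⟨⟨h, hne⟩, hj⟩
        simp [hc] at this
    · have : (1 : ℝ) ≤ (((Finset.univ.filter fun j : Fin n =>
        ∃ h : (j : ℕ) + 1 < n, x ⟨j + 1, h⟩ ≠ x j).filter (· ∈ bucket n i)).card : ℝ) := by
        exact_mod_cast Nat.one_le_iff_ne_zero.2 hc
      nlinarith [sq_nonneg (signMean ℓ x i)]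
  refine (Finset.sum_le_sum fun i _ => h1 i).trans ?_
  rw [← Nat.cast_sum, Nat.cast_le, flips, ← Finset.card_biUnion]
  · refine Finset.card_le_card fun j hj => ?_
    simp only [Finset.mem_biUnion] at hj
    obtain ⟨i, -, hj⟩ := hj
    exact (Finset.mem_filter.1 hj).1
  · intro i _ i' _ hne
    refine Finset.disjoint_left.2 fun j hj hj' => ?_
    exact Finset.disjoint_left.1 (disjoint_bucket n hne) (Finset.mem_filter.1 hj).2
      (Finset.mem_filter.1 hj').2

/-! ### Nets and products of sub-Gaussian variables -/

/-- A maximal `1/2`-separated subset of the unit ball is a `1/2`-net of at most `5 ^ d` points. -/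
lemma exists_half_net (d : ℕ) : ∃ s : Finset (E d), s.card ≤ 5 ^ d ∧ (∀ c ∈ s, ‖c‖ ≤ 1) ∧
    ∀ x : E d, ‖x‖ ≤ 1 → ∃ c ∈ s, ‖x - c‖ ≤ 1 / 2 := by
  classical
  set P : ℕ → Prop := fun k => ∃ s : Finset (E d), s.card = k ∧ (∀ c ∈ s, ‖c‖ ≤ 1) ∧
    ∀ c ∈ s, ∀ c' ∈ s, c ≠ c' → 1 / 2 ≤ ‖c - c'‖ with hP
  have hbound : ∀ s : Finset (E d), (∀ c ∈ s, ‖c‖ ≤ 1) →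
      (∀ c ∈ s, ∀ c' ∈ s, c ≠ c' → 1 / 2 ≤ ‖c - c'‖) → s.card ≤ 5 ^ d := by
    intro s h1 h2
    have hinj : Function.Injective fun x : E d => (2 : ℝ) • x :=
      smul_right_injective _ two_ne_zero
    have := Besicovitch.card_le_of_separated (s.image fun x : E d => (2 : ℝ) • x) ?_ ?_
    · rwa [Finset.card_image_of_injective _ hinj, finrank_euclideanSpace_fin] at this
    · intro c hc
      obtain ⟨x, hx, rfl⟩ := Finset.mem_image.1 hc
      rw [norm_smul]
      norm_num
      exact h1 x hx
    · intro c hc c' hc' hne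
      obtain ⟨x, hx, rfl⟩ := Finset.mem_image.1 hc
      obtain ⟨x', hx', rfl⟩ := Finset.mem_image.1 hc'
      have := h2 x hx x' hx' fun h => hne (by rw [h])
      rw [← smul_sub, norm_smul]
      norm_num
      linarith
  obtain ⟨s, hs, h1, h2⟩ : P (Nat.findGreatest P (5 ^ d)) :=
    Nat.findGreatest_spec (P := P) (Nat.zero_le _) ⟨∅, by simp⟩
  refine ⟨s, hbound s h1 h2, h1, fun x hx => ?_⟩
  by_contra! hcon
  have hxs : x ∉ s := fun h => by have := hcon x h; norm_num at this
  have h1' : ∀ c ∈ insert x s, ‖c‖ ≤ 1 := by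
    intro c hc
    rcases Finset.mem_insert.1 hc with rfl | hc
    · exact hx
    · exact h1 c hc
  have h2' : ∀ c ∈ insert x s, ∀ c' ∈ insert x s, c ≠ c' → 1 / 2 ≤ ‖c - c'‖ := by
    intro c hc c' hc' hne
    rcases Finset.mem_insert.1 hc with h | h <;> rcases Finset.mem_insert.1 hc' with h' | h'
    · exact absurd (h.trans h'.symm) hne
    · rw [h]; exact (hcon c' h').le
    · rw [h', norm_sub_rev]; exact (hcon c h).le
    · exact h2 c h c' h' hne
  have hcard := Finset.card_insert_of_notMem hxs
  have := Nat.le_findGreatest (P := P) (hbound _ h1' h2') ⟨_, rfl, h1', h2'⟩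
  omega

lemma norm_le_of_half_net {d : ℕ} {s : Finset (E d)}
    (hs : ∀ x : E d, ‖x‖ ≤ 1 → ∃ c ∈ s, ‖x - c‖ ≤ 1 / 2) {v : E d} {b : ℝ}
    (hb : ∀ c ∈ s, inner ℝ c v ≤ b) : ‖v‖ ≤ 2 * b := by
  have key : ∀ x : E d, ‖x‖ ≤ 1 → inner ℝ x v ≤ b + ‖v‖ / 2 := by
    intro x hx
    obtain ⟨c, hc, hxc⟩ := hs x hx
    have h1 : inner ℝ x v = inner ℝ c v + inner ℝ (x - c) v := by rw [inner_sub_left]; ring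
    have h2 := real_inner_le_norm (x - c) v
    have h3 := mul_le_mul_of_nonneg_right hxc (norm_nonneg v)
    linarith [hb c hc]
  rcases eq_or_ne v 0 with rfl | hv
  · have := key 0 (by simp)
    simpa using this
  · have hv' : 0 < ‖v‖ := norm_pos_iff.2 hv
    have := key (‖v‖⁻¹ • v) (by rw [norm_smul, norm_inv, norm_norm, inv_mul_cancel₀ hv'.ne'])
    rw [inner_smul_left, real_inner_self_eq_norm_sq] at this
    have e : ‖v‖⁻¹ * ‖v‖ ^ 2 = ‖v‖ := by field_simp
    simp only [conj_trivial, e] at this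
    linarith

section SubGaussian

variable {Ω : Type*} [MeasurableSpace Ω] {μ : Measure Ω}

lemma hasSubgaussianMGF_mono {X : Ω → ℝ} {c c' : ℝ≥0} (h : HasSubgaussianMGF X c μ) (hc : c ≤ c') :
    HasSubgaussianMGF X c' μ :=
  ⟨h.integrable_exp_mul, fun t => (h.mgf_le t).trans (by gcongr)⟩

/-- The moment generating function touches its bound `exp (c t² / 2)` at `t = 0`, so that both have
derivative zero there. -/
lemma hasSubgaussianMGF_integral_eq_zero [IsProbabilityMeasure μ] {X : Ω → ℝ} {c : ℝ≥0}
    (h : HasSubgaussianMGF X c μ) : ∫ ω, X ω ∂μ = 0 := by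
  have h0 : (0 : ℝ) ∈ interior (integrableExpSet X μ) := by simp [h.integrableExpSet_eq_univ]
  have h1 : HasDerivAt (mgf X μ) (∫ ω, X ω ∂μ) 0 := by
    simpa using hasDerivAt_mgf h0
  have h2 : HasDerivAt (fun t : ℝ => Real.exp (c * t ^ 2 / 2)) 0 0 := by
    have : HasDerivAt (fun t : ℝ => Real.exp (c * t ^ 2 / 2))
        (Real.exp (c * 0 ^ 2 / 2) * (c * (2 * 0 ^ (2 - 1) * 1) / 2)) 0 :=
      ((((hasDerivAt_id (0 : ℝ)).pow 2).const_mul (c : ℝ)).div_const 2).exp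
    simpa using this
  have hmin : IsLocalMin (fun t => Real.exp (c * t ^ 2 / 2) - mgf X μ t) 0 :=
    Filter.Eventually.of_forall fun t => by
      simpa [mgf_zero] using h.mgf_le t
  have := hmin.hasDerivAt_eq_zero (h2.sub h1)
  linarith

lemma lintegral_exp_sq_div_eight_gaussian_le :
    ∫⁻ g, ENNReal.ofReal (Real.exp (g ^ 2 / 8)) ∂(gaussianReal 0 1) ≤ 2 := by
  rw [gaussianReal_of_var_ne_zero _ one_ne_zero,
    lintegral_withDensity_eq_lintegral_mul _ (measurable_gaussianPDF _ _) (by fun_prop)]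
  have e : ∀ g : ℝ, (gaussianPDF 0 1 * fun g => ENNReal.ofReal (Real.exp (g ^ 2 / 8))) g =
      ENNReal.ofReal ((√(2 * Real.pi))⁻¹ * Real.exp (-(3 / 8) * g ^ 2)) := by
    intro g
    rw [Pi.mul_apply, gaussianPDF_def, ← ENNReal.ofReal_mul (gaussianPDFReal_nonneg _ _ _),
      gaussianPDFReal_def]
    simp only [NNReal.coe_one, mul_one, sub_zero]
    rw [mul_assoc, ← Real.exp_add]
    ring_nf
  simp only [e]
  rw [← ofReal_integral_eq_lintegral_ofReal
    ((integrable_exp_neg_mul_sq (by norm_num : (0 : ℝ) < 3 / 8)).const_mul _)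
    (Filter.Eventually.of_forall fun g => by positivity),
    integral_const_mul, integral_gaussian]
  rw [show (2 : ℝ≥0∞) = ENNReal.ofReal 2 by simp]
  refine ENNReal.ofReal_le_ofReal ?_
  have hpi := Real.pi_pos
  rw [inv_mul_le_iff₀ (by positivity), Real.sqrt_le_left (by positivity), mul_pow,
    Real.sq_sqrt (by positivity)]
  linarith

/-- With `g` standard Gaussian, `exp (x² / 8) = 𝔼 exp (x g / 2)`; exchanging the integrals reduces
the claim to the case where `X` itself is Gaussian. -/
lemma lintegral_exp_sq_div_eight_le [SFinite μ] {X : Ω → ℝ} (hX : Measurable X)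
    (h : HasSubgaussianMGF X 1 μ) :
    ∫⁻ ω, ENNReal.ofReal (Real.exp (X ω ^ 2 / 8)) ∂μ ≤ 2 := by
  have h1 : ∀ x : ℝ, ENNReal.ofReal (Real.exp (x ^ 2 / 8)) =
      ∫⁻ g, ENNReal.ofReal (Real.exp (x / 2 * g)) ∂(gaussianReal 0 1) := by
    intro x
    have := congrFun (mgf_fun_id_gaussianReal (μ := 0) (v := 1)) (x / 2)
    rw [← ofReal_integral_eq_lintegral_ofReal (integrable_exp_mul_gaussianReal _)
      (Filter.Eventually.of_forall fun g => (Real.exp_pos _).le)]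
    rw [mgf] at this
    rw [this]
    congr 2
    simp
    ring
  simp only [h1]
  rw [lintegral_lintegral_swap (by fun_prop)]
  refine le_trans (lintegral_mono fun g => ?_) lintegral_exp_sq_div_eight_gaussian_le
  have e : ∀ ω, X ω / 2 * g = g / 2 * X ω := fun ω => by ring
  simp only [e]
  rw [← ofReal_integral_eq_lintegral_ofReal (h.integrable_exp_mul _)
      (Filter.Eventually.of_forall fun g => (Real.exp_pos _).le)]
  refine ENNReal.ofReal_le_ofReal ((h.mgf_le (g / 2)).trans (Real.exp_le_exp.2 ?_))
  simp
  linarith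

lemma exp_le_one_add_add_sq_mul_exp_abs (u : ℝ) :
    Real.exp u ≤ 1 + u + u ^ 2 * Real.exp |u| := by
  rcases le_or_gt |u| 1 with h | h
  · have h1 := (abs_le.1 (Real.abs_exp_sub_one_sub_id_le h)).2
    have h2 : u ^ 2 * 1 ≤ u ^ 2 * Real.exp |u| := by
      gcongr
      exact Real.one_le_exp (abs_nonneg u)
    linarith
  · have h1 : 1 ≤ Real.exp |u| := Real.one_le_exp (abs_nonneg u)
    rcases le_or_gt 0 u with hu | hu
    · rw [abs_of_nonneg hu] at h h1 ⊢
      have : 1 * Real.exp u ≤ u ^ 2 * Real.exp u := by gcongr; nlinarith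
      linarith
    · rw [abs_of_neg hu] at h h1 ⊢
      have : Real.exp u ≤ 1 := Real.exp_le_one_iff.2 hu.le
      nlinarith [sq_nonneg u]

/-- Bernstein-type bound for the exponential moments, near zero, of a centred product of
sub-Gaussian variables. -/
lemma lintegral_exp_mul_centred_product_le [IsProbabilityMeasure μ] {X Y : Ω → ℝ} {c l : ℝ}
    (hX : Measurable X) (hY : Measurable Y)
    (hXs : HasSubgaussianMGF X 1 μ) (hYs : HasSubgaussianMGF Y 1 μ)
    (hc : ∫ ω, X ω * Y ω ∂μ = c) (hc1 : |c| ≤ 1) (hl : |l| ≤ 1 / 16) :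
    ∫⁻ ω, ENNReal.ofReal (Real.exp (l * (X ω * Y ω - c))) ∂μ ≤
      ENNReal.ofReal (Real.exp (2048 * l ^ 2)) := by
  have hsq : ∀ {Z : Ω → ℝ}, Measurable Z → HasSubgaussianMGF Z 1 μ →
      Integrable (fun ω => Real.exp (Z ω ^ 2 / 8)) μ ∧ ∫ ω, Real.exp (Z ω ^ 2 / 8) ∂μ ≤ 2 := by
    intro Z hZ hZs
    have h := lintegral_exp_sq_div_eight_le hZ hZs
    have hnn : 0 ≤ᵐ[μ] fun ω => Real.exp (Z ω ^ 2 / 8) :=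
      Filter.Eventually.of_forall fun ω => (Real.exp_pos _).le
    refine ⟨⟨by fun_prop, ?_⟩, ?_⟩
    · rw [hasFiniteIntegral_iff_ofReal hnn]
      exact h.trans_lt (by simp)
    · rw [integral_eq_lintegral_of_nonneg_ae hnn (by fun_prop)]
      exact ENNReal.toReal_le_of_le_ofReal (by norm_num) (by simpa using h)
  obtain ⟨hXi, hX2⟩ := hsq hX hXs
  obtain ⟨hYi, hY2⟩ := hsq hY hYs
  have hXY : Integrable (fun ω => X ω * Y ω) μ :=
    MemLp.integrable_mul (p := 2) (q := 2) (by simpa using hXs.memLp 2) (by simpa using hYs.memLp 2)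
  have hDi : Integrable (fun ω => X ω * Y ω - c) μ := hXY.sub (integrable_const _)
  have hD0 : ∫ ω, (X ω * Y ω - c) ∂μ = 0 := by
    rw [integral_sub hXY (integrable_const _), hc]; simp
  have hpt : ∀ ω, Real.exp (l * (X ω * Y ω - c)) ≤ 1 + l * (X ω * Y ω - c) +
      512 * l ^ 2 * (Real.exp (X ω ^ 2 / 8) + Real.exp (Y ω ^ 2 / 8)) := by
    intro ω
    set D := X ω * Y ω - c with hD
    refine (exp_le_one_add_add_sq_mul_exp_abs _).trans (add_le_add le_rfl ?_)
    have hDle : |D| ≤ (X ω ^ 2 + Y ω ^ 2) / 2 + 1 := by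
      have h1 : |X ω * Y ω| ≤ (X ω ^ 2 + Y ω ^ 2) / 2 := by
        rw [abs_le]; constructor <;> nlinarith [sq_nonneg (X ω + Y ω), sq_nonneg (X ω - Y ω)]
      exact (abs_sub _ _).trans (by linarith)
    have hD2 : D ^ 2 ≤ 512 * Real.exp (|D| / 16) := by
      have := Real.quadratic_le_exp_of_nonneg (x := |D| / 16) (by positivity)
      rw [div_pow, sq_abs] at this
      nlinarith [abs_nonneg D]
    have hlD : |l * D| ≤ |D| / 16 := by
      rw [abs_mul]; nlinarith [abs_nonneg D]
    have hexp8 : Real.exp (1 / 8) ≤ 2 := by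
      have := Real.exp_bound_div_one_sub_of_interval (x := 1 / 8) (by norm_num) (by norm_num)
      exact this.trans (by norm_num)
    calc (l * D) ^ 2 * Real.exp |l * D|
        ≤ (l ^ 2 * (512 * Real.exp (|D| / 16))) * Real.exp (|D| / 16) := by
          rw [mul_pow]; gcongr
      _ = 512 * l ^ 2 * Real.exp (|D| / 8) := by
          have : Real.exp (|D| / 8) = Real.exp (|D| / 16) * Real.exp (|D| / 16) := by
            rw [← Real.exp_add]; ring_nf
          rw [this]; ring
      _ ≤ 512 * l ^ 2 * (Real.exp (1 / 8) *
            (Real.exp (X ω ^ 2 / 16) * Real.exp (Y ω ^ 2 / 16))) := by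
          rw [← Real.exp_add, ← Real.exp_add]
          gcongr
          linarith
      _ ≤ 512 * l ^ 2 * (Real.exp (X ω ^ 2 / 8) + Real.exp (Y ω ^ 2 / 8)) := by
          have e : ∀ x : ℝ, Real.exp (x ^ 2 / 8) = Real.exp (x ^ 2 / 16) ^ 2 := fun x => by
            rw [← Real.exp_nat_mul]; congr 1; push_cast; ring
          rw [e, e]
          gcongr
          have hp : 0 ≤ Real.exp (X ω ^ 2 / 16) * Real.exp (Y ω ^ 2 / 16) := by positivity
          nlinarith [sq_nonneg (Real.exp (X ω ^ 2 / 16) - Real.exp (Y ω ^ 2 / 16))]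
  have hRi : Integrable (fun ω => 1 + l * (X ω * Y ω - c) +
      512 * l ^ 2 * (Real.exp (X ω ^ 2 / 8) + Real.exp (Y ω ^ 2 / 8))) μ :=
    ((integrable_const _).add (hDi.const_mul _)).add ((hXi.add hYi).const_mul _)
  calc ∫⁻ ω, ENNReal.ofReal (Real.exp (l * (X ω * Y ω - c))) ∂μ
      ≤ ∫⁻ ω, ENNReal.ofReal (1 + l * (X ω * Y ω - c) +
          512 * l ^ 2 * (Real.exp (X ω ^ 2 / 8) + Real.exp (Y ω ^ 2 / 8))) ∂μ :=
        lintegral_mono fun ω => ENNReal.ofReal_le_ofReal (hpt ω)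
    _ = ENNReal.ofReal (∫ ω, (1 + l * (X ω * Y ω - c) +
          512 * l ^ 2 * (Real.exp (X ω ^ 2 / 8) + Real.exp (Y ω ^ 2 / 8))) ∂μ) := by
        rw [ofReal_integral_eq_lintegral_ofReal hRi]
        exact Filter.Eventually.of_forall fun ω => (Real.exp_pos _).le.trans (hpt ω)
    _ ≤ _ := by
        refine ENNReal.ofReal_le_ofReal ?_
        rw [integral_add (f := fun ω => 1 + l * (X ω * Y ω - c))
            (g := fun ω => 512 * l ^ 2 * (Real.exp (X ω ^ 2 / 8) + Real.exp (Y ω ^ 2 / 8)))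
            ((integrable_const _).add (hDi.const_mul _)) ((hXi.add hYi).const_mul _),
          integral_add (integrable_const _) (hDi.const_mul _), integral_const_mul,
          integral_const_mul, hD0, integral_add hXi hYi]
        have h3 := Real.add_one_le_exp (2048 * l ^ 2)
        have h4 : 512 * l ^ 2 * (∫ ω, Real.exp (X ω ^ 2 / 8) ∂μ + ∫ ω, Real.exp (Y ω ^ 2 / 8) ∂μ)
            ≤ 512 * l ^ 2 * (2 + 2) := by gcongr
        simp
        linarith

/-- Functions of disjoint blocks of an independent family multiply under the integral. -/
lemma lintegral_prod_of_disjoint_blocks {ι κ β : Type*} [MeasurableSpace β] {f : ι → Ω → β}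
    (hf : ∀ i, Measurable (f i)) (hind : iIndepFun f μ) {S : κ → Set ι}
    (hS : Pairwise (Function.onFun Disjoint S)) {G : κ → Ω → ℝ≥0∞}
    (hG : ∀ k, Measurable[⨆ i ∈ S k, MeasurableSpace.comap (f i) inferInstance] (G k))
    (T : Finset κ) : ∫⁻ ω, ∏ k ∈ T, G k ω ∂μ = ∏ k ∈ T, ∫⁻ ω, G k ω ∂μ := by
  classical
  have : IsProbabilityMeasure μ := hind.isProbabilityMeasure
  have hle : ∀ i, MeasurableSpace.comap (f i) inferInstance ≤ ‹MeasurableSpace Ω› :=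
    fun i => (hf i).comap_le
  induction T using Finset.induction_on with
  | empty => simp
  | insert a T ha ih =>
    simp only [Finset.prod_insert ha]
    rw [← ih]
    refine lintegral_mul_eq_lintegral_mul_lintegral_of_independent_measurableSpace
      (iSup₂_le fun i _ => hle i) (iSup₂_le fun i _ => hle i)
      (indep_iSup_of_disjoint hle hind.iIndep
        (S := S a) (T := ⋃ k ∈ T, S k) ?_) (hG a) ?_
    · rw [Set.disjoint_iUnion₂_right]
      exact fun k hk => hS fun h => ha (h ▸ hk)
    · refine Finset.measurable_prod _ fun k hk => (hG k).mono ?_ le_rfl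
      exact biSup_mono fun i hi => Set.mem_biUnion (x := k) hk hi

end SubGaussian

/-! ### Concentration of the bucket sums of the noise -/

section BucketSums

variable {Ω : Type*} [MeasurableSpace Ω] {μ : Measure Ω} {n d : ℕ} {ξ : Fin n → Ω → E d}

lemma IsIsotropicSubGaussianNoise.integral_inner_mul_inner
    [IsProbabilityMeasure μ] (hξ : IsIsotropicSubGaussianNoise μ ξ) (y y' : E d) (j j' : Fin n) :
    ∫ ω, inner ℝ y (ξ j ω) * inner ℝ y' (ξ j' ω) ∂μ = if j = j' then inner ℝ y y' else 0 := by
  split_ifs with h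
  · subst h; exact hξ.isotropic j y y'
  · have hi : IndepFun (fun ω => inner ℝ y (ξ j ω)) (fun ω => inner ℝ y' (ξ j' ω)) μ :=
      (hξ.indep.indepFun h).comp (φ := fun x => inner ℝ y x) (ψ := fun x => inner ℝ y' x)
        (by fun_prop) (by fun_prop)
    rw [hi.integral_fun_mul_eq_mul_integral (hξ.subGaussian j y).aestronglyMeasurable
      (hξ.subGaussian j' y').aestronglyMeasurable,
      hasSubgaussianMGF_integral_eq_zero (hξ.subGaussian j y), zero_mul]

lemma IsIsotropicSubGaussianNoise.integral_inner_sum_mul_inner_sum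
    [IsProbabilityMeasure μ] (hξ : IsIsotropicSubGaussianNoise μ ξ) (y y' : E d)
    (b : Finset (Fin n)) :
    ∫ ω, inner ℝ y (∑ j ∈ b, ξ j ω) * inner ℝ y' (∑ j ∈ b, ξ j ω) ∂μ =
      b.card * inner ℝ y y' := by
  simp only [inner_sum, Finset.sum_mul_sum]
  have hint : ∀ j j', Integrable (fun ω => inner ℝ y (ξ j ω) * inner ℝ y' (ξ j' ω)) μ :=
    fun j j' => MemLp.integrable_mul (p := 2) (q := 2)
      (by simpa using (hξ.subGaussian j y).memLp 2) (by simpa using (hξ.subGaussian j' y').memLp 2)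
  rw [integral_finsetSum _ fun j _ => integrable_finsetSum _ fun j' _ => hint j j']
  rw [Finset.sum_congr rfl fun j _ => integral_finsetSum _ fun j' _ => hint j j']
  simp only [hξ.integral_inner_mul_inner]
  simp [Finset.sum_ite_eq]

lemma IsIsotropicSubGaussianNoise.hasSubgaussianMGF_sum
    (hξ : IsIsotropicSubGaussianNoise μ ξ) (y : E d) (b : Finset (Fin n)) (a : Fin n → ℝ) :
    HasSubgaussianMGF (fun ω => ∑ j ∈ b, a j * inner ℝ y (ξ j ω))
      (∑ j ∈ b, ‖a j‖₊ ^ 2 * ‖y‖₊ ^ 2) μ := by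
  refine HasSubgaussianMGF.sum_of_iIndepFun (X := fun j ω => a j * inner ℝ y (ξ j ω))
    (hξ.indep.comp (fun j x => a j * inner ℝ y x) fun j => by fun_prop) fun j _ => ?_
  have h := (hξ.subGaussian j y).const_mul (a j)
  refine hasSubgaussianMGF_mono h (le_of_eq ?_)
  congr 1
  ext
  rw [NNReal.coe_pow, coe_nnnorm, Real.norm_eq_abs, sq_abs]
  rfl

lemma IsIsotropicSubGaussianNoise.hasSubgaussianMGF_inner_sum
    (hξ : IsIsotropicSubGaussianNoise μ ξ) {y : E d} (hy : ‖y‖ ≤ 1) (b : Finset (Fin n)) :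
    HasSubgaussianMGF (fun ω => (√b.card)⁻¹ * inner ℝ y (∑ j ∈ b, ξ j ω)) 1 μ := by
  have h := hξ.hasSubgaussianMGF_sum y b fun _ => (√b.card)⁻¹
  simp only [← Finset.mul_sum, ← inner_sum] at h
  refine hasSubgaussianMGF_mono h ?_
  rw [← NNReal.coe_le_coe]
  push_cast
  rw [Finset.sum_const, nsmul_eq_mul, norm_inv, Real.norm_of_nonneg (Real.sqrt_nonneg _), inv_pow,
    Real.sq_sqrt (Nat.cast_nonneg _), ← mul_assoc]
  have h1 : (b.card : ℝ)⁻¹ * b.card ≤ 1 := inv_mul_le_one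
  have h2 : ‖y‖ ^ 2 ≤ 1 := pow_le_one₀ (norm_nonneg _) hy
  exact mul_le_one₀ h1 (by positivity) h2

/-- Chernoff's bound, with the exponential moment taken at `√(d / g) / (16 k)`, which is admissible
in the Bernstein-type bound because `d ≤ g`. -/
lemma IsIsotropicSubGaussianNoise.measure_bilinear_noise_ge_le
    [IsProbabilityMeasure μ] (hξ : IsIsotropicSubGaussianNoise μ ξ) {g : ℕ}
    (hd : 1 ≤ d) (hdg : d ≤ g) (hk : 1 ≤ n / g)
    {y y' : E d} (hy : ‖y‖ ≤ 1) (hy' : ‖y'‖ ≤ 1) :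
    μ {ω | 208 * (n / g : ℕ) * √(d * g) ≤ ∑ i : Fin g,
      (inner ℝ y (∑ j ∈ bucket n i, ξ j ω) * inner ℝ y' (∑ j ∈ bucket n i, ξ j ω) -
        (n / g : ℕ) * inner ℝ y y')} ≤ ENNReal.ofReal (Real.exp (-(5 * d))) := by
  have hk' : (0 : ℝ) < (n / g : ℕ) := by exact_mod_cast hk
  have hd' : (0 : ℝ) < d := by exact_mod_cast hd
  have hdg' : (d : ℝ) ≤ g := by exact_mod_cast hdg
  have hg' : (0 : ℝ) < g := hd'.trans_le hdg'
  set l : ℝ := √(d / g) / 16 with hl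
  have hl0 : 0 < l := by positivity
  have hl1 : |l| ≤ 1 / 16 := by
    rw [abs_of_pos hl0, hl]
    have : √((d : ℝ) / g) ≤ 1 := by
      exact Real.sqrt_le_one.2 ((div_le_one hg').2 hdg')
    linarith
  have hl2 : l ^ 2 * g = d / 256 := by
    rw [hl, div_pow, Real.sq_sqrt (by positivity)]; field_simp; norm_num
  have hl3 : l * √(d * g) = d / 16 := by
    rw [hl, Real.sqrt_div (by positivity), Real.sqrt_mul (by positivity)]
    have h1 := Real.mul_self_sqrt hd'.le
    have h2 : √(g : ℝ) ≠ 0 := by positivity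
    field_simp
    nlinarith
  -- The normalized coordinates of the bucket sums.
  set X : E d → Fin g → Ω → ℝ := fun z i ω =>
    (√(bucket n i).card)⁻¹ * inner ℝ z (∑ j ∈ bucket n i, ξ j ω) with hX
  have hXm : ∀ z i, Measurable[⨆ j ∈ (bucket n i : Set (Fin n)),
      MeasurableSpace.comap (ξ j) inferInstance] (X z i) := by
    intro z i
    have hj : ∀ j ∈ bucket n i, Measurable[⨆ j ∈ (bucket n i : Set (Fin n)),
        MeasurableSpace.comap (ξ j) inferInstance] (ξ j) := fun j hj =>
      (comap_measurable (ξ j)).mono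
        (le_iSup₂_of_le (f := fun j (_ : j ∈ (bucket n i : Set (Fin n))) =>
          MeasurableSpace.comap (ξ j) inferInstance) j hj le_rfl) le_rfl
    have h1 := Finset.measurable_fun_sum (bucket n i) hj
    have h2 : Measurable fun x : E d => (√(bucket n i).card)⁻¹ * inner ℝ z x := by fun_prop
    exact h2.comp h1
  have hle : ∀ i : Fin g, (⨆ j ∈ (bucket n i : Set (Fin n)),
      MeasurableSpace.comap (ξ j) inferInstance) ≤ ‹MeasurableSpace Ω› :=
    fun i => iSup₂_le fun j _ => (hξ.measurable j).comap_le
  have hXm' : ∀ z i, Measurable (X z i) := fun z i => (hXm z i).mono (hle i) le_rfl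
  have hXY : ∀ i ω, X y i ω * X y' i ω = ((n / g : ℕ) : ℝ)⁻¹ *
      (inner ℝ y (∑ j ∈ bucket n i, ξ j ω) * inner ℝ y' (∑ j ∈ bucket n i, ξ j ω)) := by
    intro i ω
    have h1 : (√((n / g : ℕ) : ℝ))⁻¹ * (√((n / g : ℕ) : ℝ))⁻¹ = ((n / g : ℕ) : ℝ)⁻¹ := by
      rw [← mul_inv, Real.mul_self_sqrt hk'.le]
    simp only [hX, card_bucket hk]
    rw [← h1]; ring
  have hmean : ∀ i, ∫ ω, X y i ω * X y' i ω ∂μ = inner ℝ y y' := by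
    intro i
    simp only [hXY]
    rw [integral_const_mul, hξ.integral_inner_sum_mul_inner_sum, card_bucket hk]
    field_simp
  have hc1 : |(inner ℝ y y' : ℝ)| ≤ 1 :=
    (abs_real_inner_le_norm y y').trans (mul_le_one₀ hy (norm_nonneg _) hy')
  set G : Fin g → Ω → ℝ≥0∞ := fun i ω =>
    ENNReal.ofReal (Real.exp (l * (X y i ω * X y' i ω - inner ℝ y y'))) with hG
  have hGle : ∀ i, ∫⁻ ω, G i ω ∂μ ≤ ENNReal.ofReal (Real.exp (2048 * l ^ 2)) := fun i =>
    lintegral_exp_mul_centred_product_le (hXm' y i) (hXm' y' i)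
      (hξ.hasSubgaussianMGF_inner_sum hy _) (hξ.hasSubgaussianMGF_inner_sum hy' _)
      (hmean i) hc1 hl1
  have hprod : ∫⁻ ω, ∏ i, G i ω ∂μ ≤ ENNReal.ofReal (Real.exp (8 * d)) := by
    rw [lintegral_prod_of_disjoint_blocks (G := G) hξ.measurable hξ.indep
      (S := fun i : Fin g => (bucket n i : Set (Fin n)))
      (fun i i' h => Finset.disjoint_coe.2 (disjoint_bucket n h))
      (fun i => ENNReal.measurable_ofReal.comp (Real.measurable_exp.comp
        ((((hXm y i).mul (hXm y' i)).sub measurable_const).const_mul l)))]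
    refine (Finset.prod_le_prod' fun i _ => hGle i).trans (le_of_eq ?_)
    rw [Finset.prod_const, Finset.card_univ, Fintype.card_fin,
      ← ENNReal.ofReal_pow (Real.exp_pos _).le, ← Real.exp_nat_mul]
    congr 2
    linear_combination 2048 * hl2
  have hsub : {ω | 208 * (n / g : ℕ) * √(d * g) ≤ ∑ i : Fin g,
      (inner ℝ y (∑ j ∈ bucket n i, ξ j ω) * inner ℝ y' (∑ j ∈ bucket n i, ξ j ω) -
        (n / g : ℕ) * inner ℝ y y')} ⊆
      {ω | ENNReal.ofReal (Real.exp (13 * d)) ≤ ∏ i, G i ω} := by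
    -- The constant `208 = 13 * 16` makes the exponent `13 d` here, against `8 d` in `hprod`.
    intro ω hω
    simp only [Set.mem_ofPred_eq, hG] at hω ⊢
    rw [← ENNReal.ofReal_prod_of_nonneg fun i _ => (Real.exp_pos _).le, ← Real.exp_sum]
    refine ENNReal.ofReal_le_ofReal (Real.exp_le_exp.2 ?_)
    rw [← Finset.mul_sum]
    have h1 : ∑ i, (X y i ω * X y' i ω - inner ℝ y y') = ((n / g : ℕ) : ℝ)⁻¹ * ∑ i : Fin g,
      (inner ℝ y (∑ j ∈ bucket n i, ξ j ω) * inner ℝ y' (∑ j ∈ bucket n i, ξ j ω) -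
        (n / g : ℕ) * inner ℝ y y') := by
      rw [Finset.mul_sum]
      refine Finset.sum_congr rfl fun i _ => ?_
      rw [hXY, mul_sub, inv_mul_cancel_left₀ hk'.ne']
    rw [h1]
    have h2 : 208 * √(d * g) ≤ ((n / g : ℕ) : ℝ)⁻¹ * ∑ i : Fin g,
      (inner ℝ y (∑ j ∈ bucket n i, ξ j ω) * inner ℝ y' (∑ j ∈ bucket n i, ξ j ω) -
        (n / g : ℕ) * inner ℝ y y') := by
      rw [le_inv_mul_iff₀ hk']
      linarith
    have h3 := mul_le_mul_of_nonneg_left h2 hl0.le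
    linarith
  refine (measure_mono hsub).trans ?_
  have hGm : Measurable fun ω => ∏ i, G i ω := Finset.measurable_fun_prod _ fun i _ =>
    ENNReal.measurable_ofReal.comp (Real.measurable_exp.comp
        ((((hXm' y i).mul (hXm' y' i)).sub measurable_const).const_mul l))
  refine (meas_ge_le_lintegral_div hGm.aemeasurable (by simp [Real.exp_pos]) (by simp)).trans ?_
  refine (ENNReal.div_le_div_right hprod _).trans (le_of_eq ?_)
  rw [← ENNReal.ofReal_div_of_pos (Real.exp_pos _), ← Real.exp_sub]
  ring_nf

lemma ofReal_exp_neg_nat_mul (d : ℕ) {a b : ℝ} {N : ℕ} (hN : (N : ℝ) ≤ Real.exp a) :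
    ((N : ℝ≥0∞) ^ d) * ENNReal.ofReal (Real.exp (-(b * d))) ≤
      ENNReal.ofReal (Real.exp (-((b - a) * d))) := by
  rw [← ENNReal.ofReal_natCast, ← ENNReal.ofReal_pow (by positivity),
    ← ENNReal.ofReal_mul (by positivity)]
  refine ENNReal.ofReal_le_ofReal ?_
  calc (N : ℝ) ^ d * Real.exp (-(b * d)) ≤ Real.exp a ^ d * Real.exp (-(b * d)) := by gcongr
    _ = _ := by rw [← Real.exp_nat_mul, ← Real.exp_add]; ring_nf

/-- The noise matrix is controlled through its bilinear form on pairs of points of a `1/2`-net; the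
at most `25 ^ d ≤ e^{4 d}` pairs are absorbed by the probability `e^{-5 d}` of each of them. -/
lemma IsIsotropicSubGaussianNoise.measure_quadratic_noise_le
    [IsProbabilityMeasure μ] (hξ : IsIsotropicSubGaussianNoise μ ξ) {g : ℕ}
    (hd : 1 ≤ d) (hdg : d ≤ g) (hk : 1 ≤ n / g) :
    μ {ω | ∃ x : E d, 832 * (n / g : ℕ) * √(d * g) * ‖x‖ < ‖∑ i : Fin g,
      (inner ℝ (∑ j ∈ bucket n i, ξ j ω) x • (∑ j ∈ bucket n i, ξ j ω) -
        ((n / g : ℕ) : ℝ) • x)‖} ≤ ENNReal.ofReal (Real.exp (-d)) := by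
  obtain ⟨s, hcard, hs1, hs⟩ := exists_half_net d
  set Z : Fin g → Ω → E d := fun i ω => ∑ j ∈ bucket n i, ξ j ω with hZ
  set Q : Ω → E d → E d := fun ω x => ∑ i : Fin g, (inner ℝ (Z i ω) x • Z i ω -
    ((n / g : ℕ) : ℝ) • x) with hQ
  have hQi : ∀ ω x y, inner ℝ y (Q ω x) = ∑ i : Fin g, (inner ℝ y (Z i ω) * inner ℝ x (Z i ω) -
      (n / g : ℕ) * inner ℝ y x) := by
    intro ω x y
    simp only [hQ, inner_sum, inner_sub_right, inner_smul_right]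
    refine Finset.sum_congr rfl fun i _ => ?_
    rw [real_inner_comm x]; ring
  have hQs : ∀ ω x y, inner ℝ y (Q ω x) = inner ℝ x (Q ω y) := by
    intro ω x y
    rw [hQi, hQi]
    refine Finset.sum_congr rfl fun i _ => ?_
    rw [real_inner_comm x y]; ring
  have hsub : {ω | ∃ x : E d, 832 * (n / g : ℕ) * √(d * g) * ‖x‖ < ‖Q ω x‖} ⊆
      ⋃ p ∈ s ×ˢ s, {ω | 208 * (n / g : ℕ) * √(d * g) ≤ ∑ i : Fin g,
      (inner ℝ p.1 (Z i ω) * inner ℝ p.2 (Z i ω) - (n / g : ℕ) * inner ℝ p.1 p.2)} := by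
    intro ω hω
    by_contra hcon
    simp only [Set.mem_iUnion, Set.mem_ofPred_eq, not_exists, not_le, ← hQi] at hcon
    obtain ⟨x, hx⟩ := hω
    have h1 : ∀ c ∈ s, ‖Q ω c‖ ≤ 2 * (208 * (n / g : ℕ) * √(d * g)) := fun c hc =>
      norm_le_of_half_net hs fun c' hc' => (hcon (c', c) (Finset.mk_mem_product hc' hc)).le
    have h2 : ‖Q ω x‖ ≤ 2 * (2 * (208 * (n / g : ℕ) * √(d * g)) * ‖x‖) :=
      norm_le_of_half_net hs fun c hc => by
        rw [hQs]
        refine (real_inner_le_norm _ _).trans ?_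
        rw [mul_comm]
        gcongr
        exact h1 c hc
    linarith
  refine (measure_mono hsub).trans ((measure_biUnion_finset_le _ _).trans ?_)
  calc ∑ p ∈ s ×ˢ s, μ {ω | 208 * (n / g : ℕ) * √(d * g) ≤ ∑ i : Fin g,
        (inner ℝ p.1 (Z i ω) * inner ℝ p.2 (Z i ω) - (n / g : ℕ) * inner ℝ p.1 p.2)}
      ≤ ∑ p ∈ s ×ˢ s, ENNReal.ofReal (Real.exp (-(5 * d))) := by
        refine Finset.sum_le_sum fun p hp => ?_
        rw [Finset.mem_product] at hp
        exact hξ.measure_bilinear_noise_ge_le hd hdg hk (hs1 _ hp.1) (hs1 _ hp.2)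
    _ ≤ ((25 : ℕ) : ℝ≥0∞) ^ d * ENNReal.ofReal (Real.exp (-(5 * d))) := by
        rw [Finset.sum_const, nsmul_eq_mul]
        gcongr
        rw [Finset.card_product]
        have : s.card * s.card ≤ 5 ^ d * 5 ^ d := Nat.mul_le_mul hcard hcard
        rw [← mul_pow] at this
        exact_mod_cast this
    _ ≤ ENNReal.ofReal (Real.exp (-((5 - 4) * d))) := by
        refine ofReal_exp_neg_nat_mul d ?_
        have h1 : (2.7 : ℝ) ≤ Real.exp 1 := by linarith [Real.exp_one_gt_d9]
        have h2 : Real.exp 4 = Real.exp 1 ^ 4 := by rw [← Real.exp_nat_mul]; norm_num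
        rw [h2]
        calc ((25 : ℕ) : ℝ) ≤ 2.7 ^ 4 := by norm_num
          _ ≤ _ := by gcongr
    _ = _ := by norm_num

/-- The cross term for fixed weights `a`, tested against the points of a net. -/
lemma IsIsotropicSubGaussianNoise.measure_linear_noise_le
    [IsProbabilityMeasure μ] (hξ : IsIsotropicSubGaussianNoise μ ξ) (hd : 1 ≤ d) (hn : 1 ≤ n)
    {s : Finset (E d)}
    (hcard : s.card ≤ 5 ^ d) (hs1 : ∀ c ∈ s, ‖c‖ ≤ 1) {g : ℕ} {a : Fin g → ℝ}
    (ha : ∀ i, |a i| ≤ 1) :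
    μ {ω | ∃ c ∈ s, 3 * √(d * n) ≤ inner ℝ c (∑ i, a i • ∑ j ∈ bucket n i, ξ j ω)} ≤
      ENNReal.ofReal (Real.exp (-d)) := by
  classical
  have hn' : (0 : ℝ) < n := by exact_mod_cast hn
  set α : Fin n → ℝ := fun j => ∑ i, if j ∈ bucket n i then a i else 0 with hα
  have hα1 : ∀ j, |α j| ≤ 1 := by
    intro j
    by_cases hj : ∃ i : Fin g, j ∈ bucket n i
    · obtain ⟨i, hi⟩ := hj
      have : α j = a i := by
        rw [hα]
        dsimp only
        rw [Finset.sum_eq_single i, if_pos hi]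
        · intro i' _ hne
          rw [if_neg fun h => Finset.disjoint_left.1 (disjoint_bucket n hne) h hi]
        · simp
      rw [this]; exact ha i
    · push Not at hj
      have : α j = 0 := by simp [hα, hj]
      rw [this]; simp
  have hsum : ∀ c ω, inner ℝ c (∑ i, a i • ∑ j ∈ bucket n i, ξ j ω) =
      ∑ j, α j * inner ℝ c (ξ j ω) := by
    intro c ω
    simp only [inner_sum, inner_smul_right, hα, Finset.sum_mul, Finset.mul_sum, ite_mul, zero_mul]
    rw [Finset.sum_comm]
    refine Finset.sum_congr rfl fun i _ => ?_
    rw [← Finset.sum_filter]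
    congr 1
    ext j
    simp
  have hone : ∀ c ∈ s, μ {ω | 3 * √(d * n) ≤ inner ℝ c (∑ i, a i • ∑ j ∈ bucket n i, ξ j ω)} ≤
      ENNReal.ofReal (Real.exp (-(4 * d))) := by
    intro c hc
    have hsg : HasSubgaussianMGF (fun ω => ∑ j, α j * inner ℝ c (ξ j ω)) (n : ℝ≥0) μ := by
      refine hasSubgaussianMGF_mono (hξ.hasSubgaussianMGF_sum c Finset.univ α) ?_
      rw [← NNReal.coe_le_coe]
      push_cast
      calc ∑ j, ‖α j‖ ^ 2 * ‖c‖ ^ 2 ≤ ∑ j : Fin n, (1 : ℝ) := by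
            refine Finset.sum_le_sum fun j _ => mul_le_one₀ ?_ (by positivity) ?_
            · exact pow_le_one₀ (norm_nonneg _) (hα1 j)
            · exact pow_le_one₀ (norm_nonneg _) (hs1 c hc)
        _ = n := by simp
    simp only [hsum]
    rw [← ofReal_measureReal]
    refine ENNReal.ofReal_le_ofReal ((hsg.measure_ge_le (by positivity)).trans ?_)
    refine Real.exp_le_exp.2 ?_
    rw [mul_pow, Real.sq_sqrt (by positivity)]
    have : -(3 ^ 2 * ((d : ℝ) * n)) / (2 * ((n : ℝ≥0) : ℝ)) = -(9 / 2 * d) := by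
      push_cast; field_simp; norm_num
    rw [this]
    have : (0 : ℝ) ≤ d := Nat.cast_nonneg d
    linarith
  have hset : {ω | ∃ c ∈ s, 3 * √(d * n) ≤ inner ℝ c (∑ i, a i • ∑ j ∈ bucket n i, ξ j ω)} =
      ⋃ c ∈ s, {ω | 3 * √(d * n) ≤ inner ℝ c (∑ i, a i • ∑ j ∈ bucket n i, ξ j ω)} := by
    ext ω; simp
  rw [hset]
  refine (measure_biUnion_finset_le _ _).trans ((Finset.sum_le_sum hone).trans ?_)
  calc ∑ c ∈ s, ENNReal.ofReal (Real.exp (-(4 * d)))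
      ≤ ((5 : ℕ) : ℝ≥0∞) ^ d * ENNReal.ofReal (Real.exp (-(4 * d))) := by
        rw [Finset.sum_const, nsmul_eq_mul]
        gcongr
        exact_mod_cast hcard
    _ ≤ ENNReal.ofReal (Real.exp (-((4 - 3) * d))) := by
        refine ofReal_exp_neg_nat_mul d ?_
        have h1 : (2.7 : ℝ) ≤ Real.exp 1 := by linarith [Real.exp_one_gt_d9]
        have h2 : Real.exp 3 = Real.exp 1 ^ 3 := by rw [← Real.exp_nat_mul]; norm_num
        rw [h2]
        calc ((5 : ℕ) : ℝ) ≤ 2.7 ^ 3 := by norm_num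
          _ ≤ _ := by gcongr
    _ = _ := by norm_num

/-- The cross term for the random weights given by the chain: by independence the joint law is a
product, and the bound for fixed weights is integrated over the law of the signs. -/
lemma IsIsotropicSubGaussianNoise.measure_cross_noise_le
    [IsProbabilityMeasure μ] (hξ : IsIsotropicSubGaussianNoise μ ξ) {η : Fin n → Ω → ℝ}
    (hη : ∀ i, Measurable (η i))
    (hind : IndepFun (fun ω i => η i ω) (fun ω i => ξ i ω) μ)
    (hd : 1 ≤ d) (hn : 1 ≤ n) {g : ℕ} (hk : 1 ≤ n / g) :
    μ {ω | (∀ i, η i ω = 1 ∨ η i ω = -1) ∧ 6 * √(d * n) < ‖∑ i : Fin g,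
      signMean g (fun j => η j ω) i • ∑ j ∈ bucket n i, ξ j ω‖} ≤
      ENNReal.ofReal (Real.exp (-d)) := by
  obtain ⟨s, hcard, hs1, hs⟩ := exists_half_net d
  set B : Set ((Fin n → ℝ) × (Fin n → E d)) := {p | (∀ i : Fin g, |signMean g p.1 i| ≤ 1) ∧
    ∃ c ∈ s, 3 * √(d * n) ≤ inner ℝ c (∑ i : Fin g, signMean g p.1 i • ∑ j ∈ bucket n i, p.2 j)}
    with hB
  have hcont : ∀ i : Fin g, Continuous fun x : Fin n → ℝ => signMean g x i := fun i => by
    unfold signMean; fun_prop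
  have hBm : MeasurableSet B := by
    have : B = {p | ∀ i : Fin g, |signMean g p.1 i| ≤ 1} ∩ ⋃ c ∈ s, {p | 3 * √(d * n) ≤
        inner ℝ c (∑ i : Fin g, signMean g p.1 i • ∑ j ∈ bucket n i, p.2 j)} := by
      ext p; simp [hB]
    rw [this]
    refine MeasurableSet.inter ?_ (Finset.measurableSet_biUnion _ fun c _ => ?_)
    · rw [Set.ofPred_forall]
      refine MeasurableSet.iInter fun i => (IsClosed.measurableSet ?_)
      exact isClosed_le ((hcont i).comp continuous_fst).abs continuous_const
    · refine measurableSet_le measurable_const ?_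
      have := fun i => (hcont i).measurable
      fun_prop
  have hηm : Measurable fun ω i => η i ω := measurable_pi_lambda _ hη
  have hξm : Measurable fun ω i => ξ i ω := measurable_pi_lambda _ hξ.measurable
  have hsub : {ω | (∀ i, η i ω = 1 ∨ η i ω = -1) ∧ 6 * √(d * n) < ‖∑ i : Fin g,
      signMean g (fun j => η j ω) i • ∑ j ∈ bucket n i, ξ j ω‖} ⊆
      (fun ω => ((fun i => η i ω), (fun i => ξ i ω))) ⁻¹' B := by
    rintro ω ⟨h1, h2⟩
    refine ⟨fun i => ?_, ?_⟩
    · rw [← sq_le_one_iff_abs_le_one]; exact signMean_sq_le_one hk h1 i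
    · by_contra! hcon
      have := norm_le_of_half_net hs fun c hc => (hcon c hc).le
      dsimp only at this
      linarith
  refine (measure_mono hsub).trans ?_
  rw [← Measure.map_apply (hηm.prodMk hξm) hBm,
    (indepFun_iff_map_prod_eq_prod_map_map hηm.aemeasurable hξm.aemeasurable).1 hind,
    Measure.prod_apply hBm]
  have : IsProbabilityMeasure (μ.map fun ω i => η i ω) :=
    Measure.isProbabilityMeasure_map hηm.aemeasurable
  calc ∫⁻ x, (μ.map fun ω i => ξ i ω) (Prod.mk x ⁻¹' B) ∂(μ.map fun ω i => η i ω)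
      ≤ ∫⁻ x, ENNReal.ofReal (Real.exp (-d)) ∂(μ.map fun ω i => η i ω) := by
        refine lintegral_mono fun x => ?_
        rw [Measure.map_apply hξm (measurable_prodMk_left hBm)]
        by_cases hx : ∀ i : Fin g, |signMean g x i| ≤ 1
        · refine (measure_mono ?_).trans (hξ.measure_linear_noise_le hd hn hcard hs1 hx)
          exact fun ω hω => hω.2
        · have : (fun ω i => ξ i ω) ⁻¹' (Prod.mk x ⁻¹' B) = ∅ := by
            ext ω; simp only [Set.mem_preimage, Set.mem_empty_iff_false, iff_false]
            exact fun h => hx h.1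
          rw [this]; simp
    _ = _ := by simp

end BucketSums

/-! ### The dyadic grid -/

lemma grid_zero (d : ℕ) : grid d 0 = d := by simp [grid]

lemma grid_succ (d i : ℕ) : grid d (i + 1) = 2 * grid d i := by
  simp only [grid, pow_succ]; ring

lemma grid_mono (d : ℕ) : Monotone (grid d) :=
  monotone_nat_of_le_succ fun i => by rw [grid_succ]; omega

lemma le_grid (d i : ℕ) : d ≤ grid d i :=
  (grid_zero d).symm.le.trans (grid_mono d (Nat.zero_le i))

lemma grid_gridTop_le {n d : ℕ} (hdn : d ≤ n) : grid d (gridTop n d) ≤ n :=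
  Nat.findGreatest_spec (P := fun i => grid d i ≤ n) (Nat.zero_le n) (by rwa [grid_zero])

/-- The cap `n` in the definition of `gridTop` is never active, because `n < 2 ^ n`. -/
lemma lt_two_mul_grid_gridTop {n d : ℕ} (hd : 1 ≤ d) : n < 2 * grid d (gridTop n d) := by
  rw [← grid_succ]
  by_contra! h
  have hle : gridTop n d + 1 ≤ n := by
    have h1 : gridTop n d + 1 < 2 ^ (gridTop n d + 1) := Nat.lt_two_pow_self
    have h2 : 2 ^ (gridTop n d + 1) * 1 ≤ grid d (gridTop n d + 1) :=
      Nat.mul_le_mul_left _ hd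
    omega
  have := Nat.le_findGreatest (P := fun i => grid d i ≤ n) hle h
  change gridTop n d + 1 ≤ gridTop n d at this
  omega

lemma one_le_div_grid {n d i : ℕ} (hd : 1 ≤ d) (hdn : d ≤ n) (hi : i ≤ gridTop n d) :
    1 ≤ n / grid d i := by
  rw [Nat.one_le_div_iff (hd.trans (le_grid d i))]
  exact (grid_mono d hi).trans (grid_gridTop_le hdn)

/-! ### Decomposition of the error matrix -/

lemma bucketMean_eq {n d : ℕ} (g : ℕ) (ξ : Fin n → E d) (i : Fin g) :
    bucketMean g ξ i = ((n / g : ℕ) : ℝ)⁻¹ • ∑ j ∈ bucket n i, ξ j := rfl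

lemma sampleCov_sub_rankOne {n d g : ℕ} (hg : 1 ≤ g) (hk : 1 ≤ n / g) (x : Fin n → ℝ) (θ : E d)
    (ξ : Fin n → E d) (u : E d) :
    Matrix.toEuclideanLin (sampleCov g fun j => x j • θ + ξ j) u - (1 / ((n / g : ℕ) : ℝ)) • u -
        (inner ℝ θ u : ℝ) • θ =
      (g : ℝ)⁻¹ • (-((∑ i : Fin g, (1 - signMean g x i ^ 2)) * inner ℝ θ u) • θ +
        ((n / g : ℕ) : ℝ)⁻¹ •
          ((inner ℝ θ u : ℝ) • (∑ i : Fin g, signMean g x i • ∑ j ∈ bucket n i, ξ j) +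
          (inner ℝ (∑ i : Fin g, signMean g x i • ∑ j ∈ bucket n i, ξ j) u : ℝ) • θ) +
        (((n / g : ℕ) : ℝ)⁻¹ ^ 2) • ∑ i : Fin g, ((inner ℝ (∑ j ∈ bucket n i, ξ j) u : ℝ) •
          (∑ j ∈ bucket n i, ξ j) - ((n / g : ℕ) : ℝ) • u)) := by
  have hk' : ((n / g : ℕ) : ℝ) ≠ 0 := by exact_mod_cast (by omega : n / g ≠ 0)
  have hg' : (g : ℝ) ≠ 0 := by exact_mod_cast (by omega : g ≠ 0)
  rw [sampleCov_apply]
  simp only [bucketMean_add_smul]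
  simp only [bucketMean_eq]
  set κ : ℝ := ((n / g : ℕ) : ℝ) with hκ
  set Z : Fin g → E d := fun i => ∑ j ∈ bucket n i, ξ j with hZ
  set a : Fin g → ℝ := fun i => signMean g x i with ha
  have e1 : ∀ i : Fin g, (inner ℝ (a i • θ + κ⁻¹ • Z i) u : ℝ) • (a i • θ + κ⁻¹ • Z i) =
      (a i ^ 2 * inner ℝ θ u) • θ + κ⁻¹ • ((inner ℝ θ u : ℝ) • (a i • Z i) +
        (inner ℝ (a i • Z i) u : ℝ) • θ) +
      (κ⁻¹ ^ 2) • ((inner ℝ (Z i) u : ℝ) • Z i - κ • u) + κ⁻¹ • u := by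
    intro i
    have hu : (κ⁻¹ ^ 2) • (κ • u) = κ⁻¹ • u := by
      rw [smul_smul]; congr 1; field_simp
    rw [smul_sub (κ⁻¹ ^ 2), hu]
    simp only [inner_add_left, inner_smul_left, conj_trivial]
    module
  have e2 : ∑ i : Fin g, (inner ℝ (a i • θ + κ⁻¹ • Z i) u : ℝ) • (a i • θ + κ⁻¹ • Z i) =
      ((∑ i, a i ^ 2) * inner ℝ θ u) • θ + κ⁻¹ • ((inner ℝ θ u : ℝ) • (∑ i, a i • Z i) +
        (inner ℝ (∑ i, a i • Z i) u : ℝ) • θ) +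
      (κ⁻¹ ^ 2) • ∑ i, ((inner ℝ (Z i) u : ℝ) • Z i - κ • u) + (g : ℝ) • (κ⁻¹ • u) := by
    simp only [e1, Finset.sum_add_distrib, ← Finset.smul_sum, ← Finset.sum_smul,
      Finset.sum_mul, sum_inner, Finset.sum_const, Finset.card_univ, Fintype.card_fin,
      ← Nat.cast_smul_eq_nsmul ℝ]
    rw [smul_comm κ⁻¹ (g : ℝ) u]
  have e3 : ∑ i, (1 - a i ^ 2) = g - ∑ i, a i ^ 2 := by simp
  change (g : ℝ)⁻¹ • ∑ i : Fin g, (inner ℝ (a i • θ + κ⁻¹ • Z i) u : ℝ) • (a i • θ + κ⁻¹ • Z i) -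
    _ - _ = _
  rw [e2, e3]
  set V := ∑ i, ((inner ℝ (Z i) u : ℝ) • Z i - κ • u)
  set W := ∑ i, a i • Z i
  have e4 : (g : ℝ)⁻¹ • ((g : ℝ) • (κ⁻¹ • u)) = (1 / κ) • u := by
    rw [inv_smul_smul₀ hg', one_div]
  have e5 : (inner ℝ θ u : ℝ) • θ = (g : ℝ)⁻¹ • ((g : ℝ) • ((inner ℝ θ u : ℝ) • θ)) := by
    rw [inv_smul_smul₀ hg']
  rw [smul_add _ _ ((g : ℝ) • (κ⁻¹ • u)), e4]
  rw [add_sub_cancel_right]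
  conv_lhs => rw [e5]
  rw [← smul_sub]
  congr 1
  module

lemma norm_sampleCov_sub_rankOne_le {n d g : ℕ} (hg : 1 ≤ g) (hk : 1 ≤ n / g) {x : Fin n → ℝ}
    {θ : E d} {ξ : Fin n → E d} {S w q : ℝ} (hS0 : 0 ≤ ∑ i : Fin g, (1 - signMean g x i ^ 2))
    (hS : ∑ i : Fin g, (1 - signMean g x i ^ 2) ≤ S)
    (hw : ‖∑ i : Fin g, signMean g x i • ∑ j ∈ bucket n i, ξ j‖ ≤ w)
    (hq : ∀ u : E d, ‖∑ i : Fin g, ((inner ℝ (∑ j ∈ bucket n i, ξ j) u : ℝ) •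
          (∑ j ∈ bucket n i, ξ j) - ((n / g : ℕ) : ℝ) • u)‖ ≤ q * ((n / g : ℕ) : ℝ) * ‖u‖)
    (u : E d) :
    ‖Matrix.toEuclideanLin (sampleCov g fun j => x j • θ + ξ j) u - (1 / ((n / g : ℕ) : ℝ)) • u -
        (inner ℝ θ u : ℝ) • θ‖ ≤
      (S * ‖θ‖ ^ 2 / g + 2 / n * (2 * ‖θ‖ * w + q)) * ‖u‖ := by
  rw [sampleCov_sub_rankOne hg hk]
  set V := ∑ i : Fin g, ((inner ℝ (∑ j ∈ bucket n i, ξ j) u : ℝ) •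
          (∑ j ∈ bucket n i, ξ j) - ((n / g : ℕ) : ℝ) • u)
  set W := ∑ i : Fin g, signMean g x i • ∑ j ∈ bucket n i, ξ j
  set S₀ := ∑ i : Fin g, (1 - signMean g x i ^ 2)
  have hV := hq u
  have hgk : (n : ℝ) ≤ 2 * (g * (n / g : ℕ)) := by
    have h1 := Nat.lt_mul_div_succ n (by omega : 0 < g)
    have h2 : g * 1 ≤ g * (n / g) := Nat.mul_le_mul_left g hk
    have h3 : n ≤ 2 * (g * (n / g)) := by rw [mul_add] at h1; omega
    exact_mod_cast h3
  have hn : (0 : ℝ) < n := by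
    have : 0 < n := by by_contra h; simp [show n = 0 by omega] at hk
    exact_mod_cast this
  set κ : ℝ := ((n / g : ℕ) : ℝ)
  have hκ : 0 < κ := by simpa [κ] using (by omega : 0 < n / g)
  have hg' : (0 : ℝ) < g := by exact_mod_cast hg
  have hq0 : 0 ≤ q * ‖u‖ := by
    have := (norm_nonneg _).trans hV
    have h : 0 ≤ κ * (q * ‖u‖) := by linarith
    exact nonneg_of_mul_nonneg_right h hκ
  have hw0 : 0 ≤ w := (norm_nonneg _).trans hw
  have hin : |(inner ℝ θ u : ℝ)| ≤ ‖θ‖ * ‖u‖ := abs_real_inner_le_norm _ _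
  have hin2 : |(inner ℝ W u : ℝ)| ≤ w * ‖u‖ :=
    (abs_real_inner_le_norm _ _).trans (by gcongr)
  have hinv : (g : ℝ)⁻¹ * κ⁻¹ ≤ 2 / n := by
    rw [← mul_inv, inv_le_comm₀ (by positivity) (by positivity), inv_div]
    linarith
  have h1 : ‖(-(S₀ * inner ℝ θ u)) • θ‖ ≤ S * ‖θ‖ ^ 2 * ‖u‖ := by
    rw [norm_smul, norm_neg, Real.norm_eq_abs, abs_mul, abs_of_nonneg hS0]
    calc S₀ * |(inner ℝ θ u : ℝ)| * ‖θ‖ ≤ S * (‖θ‖ * ‖u‖) * ‖θ‖ := by gcongr; exact hS0.trans hS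
      _ = _ := by ring
  have h2 : ‖κ⁻¹ • ((inner ℝ θ u : ℝ) • W + (inner ℝ W u : ℝ) • θ)‖ ≤
      κ⁻¹ * (2 * ‖θ‖ * w * ‖u‖) := by
    rw [norm_smul, Real.norm_of_nonneg (by positivity)]
    gcongr
    refine (norm_add_le _ _).trans ?_
    rw [norm_smul, norm_smul, Real.norm_eq_abs, Real.norm_eq_abs]
    calc |(inner ℝ θ u : ℝ)| * ‖W‖ + |(inner ℝ W u : ℝ)| * ‖θ‖
        ≤ ‖θ‖ * ‖u‖ * w + w * ‖u‖ * ‖θ‖ := by gcongr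
      _ = _ := by ring
  have h3 : ‖κ⁻¹ ^ 2 • V‖ ≤ κ⁻¹ * (q * ‖u‖) := by
    rw [norm_smul, Real.norm_of_nonneg (by positivity)]
    calc κ⁻¹ ^ 2 * ‖V‖ ≤ κ⁻¹ ^ 2 * (q * κ * ‖u‖) := by gcongr
      _ = _ := by field_simp
  rw [norm_smul, Real.norm_of_nonneg (by positivity)]
  calc (g : ℝ)⁻¹ * ‖-(S₀ * inner ℝ θ u) • θ + κ⁻¹ • ((inner ℝ θ u : ℝ) • W +
        (inner ℝ W u : ℝ) • θ) + κ⁻¹ ^ 2 • V‖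
      ≤ (g : ℝ)⁻¹ * (S * ‖θ‖ ^ 2 * ‖u‖ + κ⁻¹ * (2 * ‖θ‖ * w * ‖u‖) + κ⁻¹ * (q * ‖u‖)) := by
        gcongr
        exact (norm_add₃_le).trans (add_le_add (add_le_add h1 h2) h3)
    _ = S * ‖θ‖ ^ 2 / g * ‖u‖ + (g : ℝ)⁻¹ * κ⁻¹ * (2 * ‖θ‖ * w * ‖u‖ + q * ‖u‖) := by
        rw [div_eq_mul_inv]; ring
    _ ≤ S * ‖θ‖ ^ 2 / g * ‖u‖ + 2 / n * (2 * ‖θ‖ * w * ‖u‖ + q * ‖u‖) := by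
        gcongr
    _ = _ := by ring

/-! ### The oracle grid point and the rate -/

/-- The noise level `√(d g) / n` at the grid point `g = 2 ^ i d`. -/
noncomputable def noiseLevel (n d i : ℕ) : ℝ := √(d * grid d i) / n

lemma noiseLevel_nonneg (n d i : ℕ) : 0 ≤ noiseLevel n d i := by unfold noiseLevel; positivity

lemma noiseLevel_succ (n d i : ℕ) : noiseLevel n d (i + 1) = √2 * noiseLevel n d i := by
  unfold noiseLevel
  rw [grid_succ, ← mul_div_assoc, ← Real.sqrt_mul (by norm_num)]
  push_cast
  ring_nf

lemma noiseLevel_sq (n d i : ℕ) : noiseLevel n d i ^ 2 = d * grid d i / (n : ℝ) ^ 2 := by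
  rw [noiseLevel, div_pow, Real.sq_sqrt (by positivity)]

lemma loss_thetaTilde_le {n d g : ℕ} {v : ℕ → (Fin n → E d) → E d} (hv : IsTopEigenvectorRule v)
    {y : Fin n → E d} {θ : E d} {ε : ℝ}
    (hε : ∀ u : E d, ‖Matrix.toEuclideanLin (sampleCov g y) u - (1 / ((n / g : ℕ) : ℝ)) • u -
        (inner ℝ θ u : ℝ) • θ‖ ≤ ε * ‖u‖) :
    loss (thetaTilde v g y) θ ^ 2 ≤ 3 * ε ∧
      loss (thetaTilde v g y) θ ^ 2 * ‖θ‖ ^ 2 ≤ 12 * ε ^ 2 :=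
  loss_sq_le_of_nearly_rankOne (hv g y).1 (hv g y).2
    (inner_toEuclideanLin_le_lambdaMax (isHermitian_sampleCov g y)) hε

/-- As soon as `n t² ≤ 2 g`, the cross term is dominated by the quadratic noise. -/
lemma noise_terms_le {n d g : ℕ} {t : ℝ} (hn : 1 ≤ n) (h : n * t ^ 2 ≤ 2 * g) :
    2 / n * (2 * t * (6 * √(d * n)) + 832 * √(d * g)) ≤ 1700 * (√(d * g) / n) := by
  have hn' : (0 : ℝ) < n := by exact_mod_cast hn
  have h1 : t * √(d * n) ≤ √2 * √(d * g) := by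
    rw [← Real.sqrt_mul (by norm_num)]
    apply Real.le_sqrt_of_sq_le
    rw [mul_pow, Real.sq_sqrt (by positivity)]
    have := mul_le_mul_of_nonneg_left h (Nat.cast_nonneg (α := ℝ) d)
    linarith
  have h2 : √2 ≤ (3 / 2 : ℝ) := by rw [Real.sqrt_le_left (by norm_num)]; norm_num
  have h3 : √2 * √(d * g) ≤ 3 / 2 * √((d : ℝ) * g) := by gcongr
  rw [div_mul_eq_mul_div, ← mul_div_assoc, div_le_div_iff_of_pos_right hn']
  linarith

/-- As soon as `t⁴ δ'² n⁴ ≤ d g³`, the bias is dominated by the noise. -/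
lemma bias_term_le {n d g : ℕ} {t δ' F : ℝ} (hn : 1 ≤ n) (hg : 1 ≤ g)
    (hF : F ≤ 3 * δ' * n) (h : t ^ 4 * δ' ^ 2 * n ^ 4 ≤ d * g ^ 3) :
    F * t ^ 2 / g ≤ 3 * (√(d * g) / n) := by
  have hn' : (0 : ℝ) < n := by exact_mod_cast hn
  have hg' : (0 : ℝ) < g := by exact_mod_cast hg
  have h1 : δ' * n ^ 2 * t ^ 2 / g ≤ √(d * g) := by
    apply Real.le_sqrt_of_sq_le
    rw [div_pow, div_le_iff₀ (by positivity)]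
    calc (δ' * (n : ℝ) ^ 2 * t ^ 2) ^ 2 = t ^ 4 * δ' ^ 2 * n ^ 4 := by ring
      _ ≤ _ := h
      _ = _ := by ring
  calc F * t ^ 2 / g ≤ (3 * δ' * n) * t ^ 2 / g := by gcongr
    _ = 3 * ((δ' * n ^ 2 * t ^ 2 / g) / n) := by field_simp
    _ ≤ _ := by gcongr

/-- If the grid point `g` misses one of the two oracle conditions, then at the next grid point
`2 g`, with noise level `ν`, the bound `b² ≤ K min (ν, ν² / t²)` gives the rate `T = √(δ' d / n)`.
A miss of the second condition gives `ν² ≤ t² d / n`; a miss of the first one gives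
`ν⁶ ≤ 8 t⁴ T⁴`, hence `ν ≤ 2 T` if `t² ≤ T` and `ν² ≤ 2 t² T` otherwise. -/
lemma rate_of_oracle {n d g : ℕ} {t δ' b K ν T : ℝ} (hn : 1 ≤ n) (hK : 0 ≤ K)
    (hν2 : ν ^ 2 = d * (2 * g) / (n : ℝ) ^ 2)
    (hT : 0 ≤ T) (hT2 : T ^ 2 = δ' * d / n) (hdT : d / n ≤ T)
    (hb1 : b ^ 2 ≤ K * ν) (hb2 : b ^ 2 * t ^ 2 ≤ K * ν ^ 2)
    (hfail : ¬ (t ^ 4 * δ' ^ 2 * n ^ 4 ≤ d * (g : ℝ) ^ 3 ∧ n * t ^ 2 ≤ 2 * g)) :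
    b ^ 2 ≤ 2 * K * T := by
  have hn' : (0 : ℝ) < n := by exact_mod_cast hn
  have hKT : 0 ≤ K * T := by positivity
  by_cases hA : n * t ^ 2 ≤ 2 * g
  · have hB : d * (g : ℝ) ^ 3 ≤ t ^ 4 * δ' ^ 2 * n ^ 4 := by
      by_contra! h; exact hfail ⟨h.le, hA⟩
    have h6 : (ν ^ 2) ^ 3 ≤ 8 * t ^ 4 * T ^ 4 := by
      have e : T ^ 4 = (δ' * d / n) ^ 2 := by rw [← hT2]; ring
      rw [hν2, e]
      calc ((d : ℝ) * (2 * g) / (n : ℝ) ^ 2) ^ 3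
          = 8 * d ^ 2 * (d * (g : ℝ) ^ 3) / (n : ℝ) ^ 6 := by ring
        _ ≤ 8 * d ^ 2 * (t ^ 4 * δ' ^ 2 * n ^ 4) / (n : ℝ) ^ 6 := by gcongr
        _ = _ := by field_simp
    rcases le_or_gt (t ^ 2) T with hc | hc
    · have : (ν ^ 2) ^ 3 ≤ ((2 * T) ^ 2) ^ 3 := by
        refine h6.trans ?_
        calc 8 * t ^ 4 * T ^ 4 = 8 * (t ^ 2) ^ 2 * T ^ 4 := by ring
          _ ≤ 8 * T ^ 2 * T ^ 4 := by gcongr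
          _ ≤ _ := by nlinarith [pow_nonneg hT 6]
      have h2 := le_of_pow_le_pow_left₀ (by norm_num) (by positivity) this
      have h3 := le_of_pow_le_pow_left₀ (by norm_num) (by positivity) h2
      have := mul_le_mul_of_nonneg_left h3 hK
      linarith
    · have htp : 0 < t ^ 2 := hT.trans_lt hc
      have : (ν ^ 2) ^ 3 ≤ (2 * (t ^ 2 * T)) ^ 3 := by
        refine h6.trans ?_
        calc 8 * t ^ 4 * T ^ 4 = 8 * t ^ 4 * T ^ 3 * T := by ring
          _ ≤ 8 * t ^ 4 * T ^ 3 * t ^ 2 := by gcongr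
          _ = _ := by ring
      have h2 := le_of_pow_le_pow_left₀ (by norm_num) (by positivity) this
      have h3 := hb2.trans (mul_le_mul_of_nonneg_left h2 hK)
      have h4 : b ^ 2 * t ^ 2 ≤ (2 * K * T) * t ^ 2 := by linarith
      exact le_of_mul_le_mul_right h4 htp
  · push Not at hA
    have htp : 0 < t ^ 2 := by
      by_contra! h
      have : (0 : ℝ) ≤ 2 * g := by positivity
      nlinarith
    have h1 : ν ^ 2 ≤ d / n * t ^ 2 := by
      rw [hν2, div_le_iff₀ (by positivity)]
      have := mul_le_mul_of_nonneg_left hA.le (Nat.cast_nonneg (α := ℝ) d)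
      calc (d : ℝ) * (2 * g) ≤ d * (n * t ^ 2) := this
        _ = _ := by field_simp
    have h2 : b ^ 2 * t ^ 2 ≤ (K * T) * t ^ 2 := by
      refine hb2.trans ?_
      calc K * ν ^ 2 ≤ K * (d / n * t ^ 2) := by gcongr
        _ ≤ K * (T * t ^ 2) := by gcongr
        _ = _ := by ring
    have := le_of_mul_le_mul_right h2 htp
    linarith

/-- The constant of the risk bound: twice that of `lepski` for `B = 6812`, which satisfies
`3 * 1703 ≤ B ^ 2` and `12 * 1703 ^ 2 ≤ B ^ 2`. -/
noncomputable def riskConst (C : ℝ) : ℝ :=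
  2 * ((6812 + 28 * C) ^ 2 + 4 * (6812 + 14 * C) ^ 4)

/-- The risk bound on the event that the flips and both noise terms at all grid points are under
control; it is a deterministic statement. -/
lemma adaptiveEstimator_loss_le {n d : ℕ} (hd : 1 ≤ d) (hdn : d ≤ n) {δ C : ℝ} (hδ0 : 0 ≤ δ)
    (hC : 6812 + 6812 ^ 2 ≤ C)
    {v : ℕ → (Fin n → E d) → E d} (hv : IsTopEigenvectorRule v) {θ : E d} (hθ : ‖θ‖ ^ 2 ≤ 1)
    {x : Fin n → ℝ} {ξ : Fin n → E d} (hx : ∀ j, x j = 1 ∨ x j = -1)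
    (hflips : (flips x : ℝ) ≤ 2 * δ * n + d)
    (hw : ∀ i ≤ gridTop n d, ‖∑ a : Fin (grid d i), signMean (grid d i) x a •
      ∑ j ∈ bucket n a, ξ j‖ ≤ 6 * √(d * n))
    (hq : ∀ i ≤ gridTop n d, ∀ u : E d, ‖∑ a : Fin (grid d i),
      ((inner ℝ (∑ j ∈ bucket n a, ξ j) u : ℝ) • (∑ j ∈ bucket n a, ξ j) -
        ((n / grid d i : ℕ) : ℝ) • u)‖ ≤
      832 * ((n / grid d i : ℕ) : ℝ) * √(d * grid d i) * ‖u‖) :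
    loss (adaptiveEstimator v C fun j => x j • θ + ξ j) θ ^ 2 ≤
      riskConst C * (√(δ * d / n) + d / n) := by
  classical
  have hn : 1 ≤ n := hd.trans hdn
  have hn' : (0 : ℝ) < n := by exact_mod_cast hn
  have hd' : (0 : ℝ) < d := by exact_mod_cast hd
  set M := gridTop n d with hM
  set y : Fin n → E d := fun j => x j • θ + ξ j with hy
  set t : ℝ := ‖θ‖ with ht
  have ht0 : 0 ≤ t := norm_nonneg _
  set δ' : ℝ := max δ (d / n) with hδ'
  have hδ'0 : 0 ≤ δ' := hδ0.trans (le_max_left _ _)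
  have hF : (flips x : ℝ) ≤ 3 * δ' * n := by
    have h1 : δ * n ≤ δ' * n := by gcongr; exact le_max_left _ _
    have h2 : (d : ℝ) ≤ δ' * n := by
      rw [← div_le_iff₀ hn']; exact le_max_right _ _
    linarith
  -- Above the oracle index, the bias is dominated by the noise.
  set P : ℕ → Prop := fun i => t ^ 4 * δ' ^ 2 * n ^ 4 ≤ d * (grid d i : ℝ) ^ 3 ∧
    n * t ^ 2 ≤ 2 * grid d i with hP
  have hPmono : ∀ i j, i ≤ j → P i → P j := by
    intro i j hij hi
    have : (grid d i : ℝ) ≤ grid d j := by exact_mod_cast grid_mono d hij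
    exact ⟨hi.1.trans (by gcongr), hi.2.trans (by gcongr)⟩
  have hex : ∃ i, i = M ∨ P i := ⟨M, Or.inl rfl⟩
  set m₀ := Nat.find hex with hm₀
  have hm₀M : m₀ ≤ M := Nat.find_min' hex (Or.inl rfl)
  have habove : ∀ i, m₀ ≤ i → i ≤ M → i = M ∨ P i := by
    intro i h1 h2
    rcases Nat.find_spec hex with h | h
    · left; change m₀ = M at h; omega
    · right; exact hPmono m₀ i h1 h
  have hf : ∀ i, m₀ ≤ i → i ≤ M →
      loss (thetaTilde v (grid d i) y) θ ^ 2 ≤ 6812 ^ 2 * noiseLevel n d i ∧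
      loss (thetaTilde v (grid d i) y) θ ^ 2 * ‖θ‖ ^ 2 ≤ 6812 ^ 2 * noiseLevel n d i ^ 2 := by
    intro i h1 h2
    have hk := one_le_div_grid hd hdn h2
    have hg : 1 ≤ grid d i := hd.trans (le_grid d i)
    have hS0 : 0 ≤ ∑ a : Fin (grid d i), (1 - signMean (grid d i) x a ^ 2) :=
      Finset.sum_nonneg fun a _ => sub_nonneg.2 (signMean_sq_le_one hk hx a)
    have hS := sum_one_sub_signMean_sq_le_flips hk hx
    set S := ∑ a : Fin (grid d i), (1 - signMean (grid d i) x a ^ 2) with hSdef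
    have hbias : S * t ^ 2 / grid d i ≤ 3 * noiseLevel n d i ∧ n * t ^ 2 ≤ 2 * grid d i := by
      rcases habove i h1 h2 with h | h
      · have h3 : n < 2 * grid d i := by rw [h]; exact lt_two_mul_grid_gridTop hd
        have h4 : n / grid d i = 1 := by
          refine le_antisymm ?_ hk
          rw [← Nat.lt_succ_iff, Nat.div_lt_iff_lt_mul (by omega)]
          omega
        -- Buckets of length one: there is no bias.
        have hS0' : S = 0 := by
          refine Finset.sum_eq_zero fun a _ => ?_
          rw [signMean_sq_eq_one hk hx, sub_self]
          intro j hj h hj'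
          rw [mem_bucket, h4, Nat.div_one] at hj hj'
          dsimp only at hj'
          omega
        constructor
        · rw [hS0', zero_mul, zero_div]
          have := noiseLevel_nonneg n d i
          positivity
        · have : (n : ℝ) ≤ 2 * grid d i := by exact_mod_cast h3.le
          nlinarith
      · exact ⟨bias_term_le hn hg (hS.trans hF) h.1, h.2⟩
    have hε := norm_sampleCov_sub_rankOne_le (θ := θ) hg hk hS0 le_rfl (hw i h2)
      (q := 832 * √(d * grid d i)) fun u => (hq i h2 u).trans_eq (by ring)
    have hεle : S * t ^ 2 / grid d i + 2 / n * (2 * t * (6 * √(d * n)) +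
        832 * √(d * grid d i)) ≤ 1703 * noiseLevel n d i := by
      have := noise_terms_le (d := d) hn hbias.2
      have h3 := hbias.1
      unfold noiseLevel at h3 ⊢
      linarith
    have hfin := loss_thetaTilde_le hv (y := y) (θ := θ) fun u =>
      (hε u).trans (mul_le_mul_of_nonneg_right hεle (norm_nonneg u))
    have hν0 := noiseLevel_nonneg n d i
    constructor
    · nlinarith [hfin.1]
    · nlinarith [hfin.2, sq_nonneg (noiseLevel n d i)]
  have hlep := lepski (f := fun i => thetaTilde v (grid d i) y) (θ := θ) (ν := noiseLevel n d)
    hm₀M (by norm_num) hC (noiseLevel_nonneg n d) (noiseLevel_succ n d) hf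
  simp only [noiseLevel, ← sq_le_threshold_iff] at hlep
  change loss (adaptiveEstimator v C y) θ ^ 2 ≤ _ * noiseLevel n d m₀ ∧
    loss (adaptiveEstimator v C y) θ ^ 2 * t ^ 2 ≤ _ * noiseLevel n d m₀ ^ 2 at hlep
  set K₁ : ℝ := (6812 + 28 * C) ^ 2 + 4 * (6812 + 14 * C) ^ 4 with hK₁
  have hK₁0 : 0 ≤ K₁ := by positivity
  have hsq0 : 0 ≤ √(δ * d / n) := Real.sqrt_nonneg _
  have hdn0 : 0 ≤ (d : ℝ) / n := by positivity
  obtain ⟨hb1, hb2⟩ := hlep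
  rw [riskConst, ← hK₁]
  rcases Nat.eq_zero_or_pos m₀ with h0 | hpos
  · have hν : noiseLevel n d m₀ = d / n := by
      rw [h0, noiseLevel, grid_zero, Real.sqrt_mul_self hd'.le]
    rw [hν] at hb1
    nlinarith [mul_nonneg hK₁0 hsq0, mul_nonneg hK₁0 hdn0]
  · have hfail := Nat.find_min hex (m := m₀ - 1) (by omega)
    push Not at hfail
    have hgrid : grid d m₀ = 2 * grid d (m₀ - 1) := by
      rw [← grid_succ]; congr 1; omega
    have hν2 : noiseLevel n d m₀ ^ 2 = d * (2 * grid d (m₀ - 1)) / (n : ℝ) ^ 2 := by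
      rw [noiseLevel_sq, hgrid]; push_cast; ring
    have hdT : (d : ℝ) / n ≤ √(δ' * d / n) := by
      apply Real.le_sqrt_of_sq_le
      have : (d : ℝ) / n ≤ δ' := le_max_right _ _
      calc ((d : ℝ) / n) ^ 2 = d / n * (d / n) := sq _
        _ ≤ δ' * (d / n) := by gcongr
        _ = _ := by ring
    have hT : √(δ' * d / n) ≤ √(δ * d / n) + d / n := by
      rcases max_choice δ (d / n) with h | h <;> rw [hδ', h]
      · linarith
      · have : (d : ℝ) / n * d / n = (d / n) * (d / n) := by ring
        rw [this, Real.sqrt_mul_self hdn0]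
        linarith
    have := rate_of_oracle hn hK₁0 hν2 (Real.sqrt_nonneg _)
      (Real.sq_sqrt (by positivity)) hdT hb1 hb2 (fun h => hfail.2 h)
    refine this.trans ?_
    gcongr

lemma measure_loss_gt_le {Ω : Type*} [MeasurableSpace Ω] {μ : Measure Ω} [IsProbabilityMeasure μ]
    {n d : ℕ} (hd : 1 ≤ d) (hdn : d ≤ n) {δ C : ℝ} (hδ0 : 0 ≤ δ) (hδ1 : δ ≤ 1)
    (hC : 6812 + 6812 ^ 2 ≤ C)
    {v : ℕ → (Fin n → E d) → E d} (hv : IsTopEigenvectorRule v) {θ : E d} (hθ : ‖θ‖ ^ 2 ≤ 1)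
    {η : Fin n → Ω → ℝ} {ξ : Fin n → Ω → E d} (hη : IsSymmetricSignChain μ δ η)
    (hξ : IsIsotropicSubGaussianNoise μ ξ)
    (hind : IndepFun (fun ω i => η i ω) (fun ω i => ξ i ω) μ) :
    μ {ω | riskConst C * (√(δ * d / n) + d / n) <
        loss (adaptiveEstimator v C (observations θ η ξ ω)) θ ^ 2} ≤
      ENNReal.ofReal ((2 * gridTop n d + 3) * Real.exp (-d)) := by
  set M := gridTop n d with hM
  set A : Set Ω := {ω | ¬ ((∀ i, η i ω = 1 ∨ η i ω = -1) ∧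
      (flips (fun i => η i ω) : ℝ) ≤ 2 * δ * n + d)} with hA
  set B : ℕ → Set Ω := fun i => {ω | (∀ i, η i ω = 1 ∨ η i ω = -1) ∧
    6 * √(d * n) < ‖∑ a : Fin (grid d i),
      signMean (grid d i) (fun j => η j ω) a • ∑ j ∈ bucket n a, ξ j ω‖} with hB
  set D : ℕ → Set Ω := fun i => {ω | ∃ x : E d,
    832 * (n / grid d i : ℕ) * √(d * grid d i) * ‖x‖ < ‖∑ a : Fin (grid d i),
      ((inner ℝ (∑ j ∈ bucket n a, ξ j ω) x : ℝ) • (∑ j ∈ bucket n a, ξ j ω) -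
        ((n / grid d i : ℕ) : ℝ) • x)‖} with hD
  have hsub : {ω | riskConst C * (√(δ * d / n) + d / n) <
      loss (adaptiveEstimator v C (observations θ η ξ ω)) θ ^ 2} ⊆
      A ∪ ⋃ i ∈ Finset.range (M + 1), (B i ∪ D i) := by
    intro ω hω
    by_contra hcon
    rw [Set.mem_union, not_or] at hcon
    obtain ⟨hx, hfl⟩ := not_not.1 hcon.1
    have hBD := hcon.2
    simp only [Set.mem_union, Set.mem_iUnion, not_or, not_exists, hB, hD, Set.mem_ofPred_eq,
      not_and, not_lt, Finset.mem_range, Nat.lt_succ_iff] at hBD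
    refine absurd (adaptiveEstimator_loss_le hd hdn hδ0 hC hv hθ hx hfl
      (fun i hi => (hBD i hi).1 hx) fun i hi => (hBD i hi).2) (not_le.2 ?_)
    exact hω
  refine (measure_mono hsub).trans ((measure_union_le _ _).trans ?_)
  have hmain : ∀ i ∈ Finset.range (M + 1), μ (B i ∪ D i) ≤
      ENNReal.ofReal (2 * Real.exp (-d)) := by
    intro i hi
    have hi' : i ≤ M := Nat.lt_succ_iff.1 (Finset.mem_range.1 hi)
    have hk := one_le_div_grid hd hdn hi'
    refine (measure_union_le _ _).trans ?_
    rw [two_mul, ENNReal.ofReal_add (Real.exp_pos _).le (Real.exp_pos _).le]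
    exact add_le_add
      (hξ.measure_cross_noise_le hη.measurable hind hd (hd.trans hdn) hk)
      (hξ.measure_quadratic_noise_le hd (le_grid d i) hk)
  calc μ A + μ (⋃ i ∈ Finset.range (M + 1), (B i ∪ D i))
      ≤ ENNReal.ofReal (Real.exp (-d)) +
          ∑ i ∈ Finset.range (M + 1), ENNReal.ofReal (2 * Real.exp (-d)) := by
        gcongr
        · exact measure_not_signs_or_flips_gt_le hη (hd.trans hdn) hδ0 hδ1 d
        · exact (measure_biUnion_finset_le _ _).trans (Finset.sum_le_sum hmain)
    _ = _ := by
        rw [← ENNReal.ofReal_sum_of_nonneg (fun i _ => by positivity),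
          ← ENNReal.ofReal_add (by positivity) (by positivity)]
        congr 1
        simp
        ring

lemma gridTop_self (d : ℕ) (hd : 1 ≤ d) : gridTop d d = 0 := by
  have h := grid_gridTop_le (le_refl d)
  by_contra hne
  have h1 := grid_mono d (Nat.one_le_iff_ne_zero.2 hne)
  rw [show (1 : ℕ) = 0 + 1 from rfl, grid_succ, grid_zero] at h1
  omega

/-- Since `log (n / d) ≥ 1 / (d + 1)` for `n ≥ d + 1`, half of the exponent turns the additive
constant into a multiple of `log (n / d)`. -/
lemma two_mul_gridTop_add_three_le {n d : ℕ} (hd : 1 ≤ d) (hdn : d < n) :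
    (2 * gridTop n d + 3) * Real.exp (-d) ≤
      10 * Real.log (n / d) * Real.exp (-(1 / 2 * d)) := by
  have hd' : (0 : ℝ) < d := by exact_mod_cast hd
  have hn' : (0 : ℝ) < n := hd'.trans (by exact_mod_cast hdn)
  have hdn' : (d : ℝ) + 1 ≤ n := by exact_mod_cast hdn
  set L := Real.log (n / d) with hL
  set e := Real.exp (1 / 2 * d) with he
  have he1 : 1 + d / 2 ≤ e := by
    have := Real.add_one_le_exp (1 / 2 * (d : ℝ)); linarith
  have hL1 : 1 / ((d : ℝ) + 1) ≤ L := by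
    have h1 := Real.one_sub_inv_le_log_of_pos (x := (n : ℝ) / d) (by positivity)
    have h2 : (d : ℝ) / n ≤ d / (d + 1) := by gcongr
    have h3 : 1 - (d : ℝ) / (d + 1) = 1 / (d + 1) := by field_simp; ring
    rw [inv_div] at h1
    linarith
  have hL0 : 0 < L := lt_of_lt_of_le (by positivity) hL1
  have hM : (gridTop n d : ℝ) ≤ 2 * L := by
    have h1 : (2 : ℝ) ^ gridTop n d ≤ n / d := by
      rw [le_div_iff₀ hd']
      exact_mod_cast grid_gridTop_le hdn.le
    have h2 := Real.log_le_log (by positivity) h1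
    rw [Real.log_pow] at h2
    have h3 := Real.log_two_gt_d9
    have h4 : (0 : ℝ) ≤ gridTop n d := Nat.cast_nonneg _
    nlinarith
  have hLe : 1 / 2 ≤ L * e := by
    calc (1 / 2 : ℝ) = 1 / ((d : ℝ) + 1) * ((d + 1) / 2) := by field_simp
      _ ≤ L * e := by gcongr; linarith
  have hexp : Real.exp (-d) = Real.exp (-(1 / 2 * d)) * Real.exp (-(1 / 2 * d)) := by
    rw [← Real.exp_add]; ring_nf
  have hee : e * Real.exp (-(1 / 2 * d)) = 1 := by rw [he, ← Real.exp_add]; simp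
  have hp := Real.exp_pos (-(1 / 2 * (d : ℝ)))
  have hkey : 2 * (gridTop n d : ℝ) + 3 ≤ 10 * L * e := by nlinarith
  calc (2 * (gridTop n d : ℝ) + 3) * Real.exp (-d) ≤ (10 * L * e) * Real.exp (-d) := by gcongr
    _ = 10 * L * Real.exp (-(1 / 2 * d)) * (e * Real.exp (-(1 / 2 * d))) := by rw [hexp]; ring
    _ = _ := by rw [hee, mul_one]

end BinaryHMM

theorem theorem4 :
    ∃ C₀ c₀ c₁ : ℝ, 0 < C₀ ∧ 0 < c₀ ∧ 0 < c₁ ∧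
      ∀ C : ℝ, C₀ ≤ C → ∃ K : ℝ, 0 < K ∧
        ∀ (n d : ℕ), 1 ≤ d → d ≤ n →
        ∀ (δ : ℝ), 0 < δ → δ < 1 / 2 →
        ∀ (θ : BinaryHMM.E d), ‖θ‖ ^ 2 ≤ 1 →
        ∀ (Ω : Type*) [MeasurableSpace Ω] (μ : Measure Ω) [IsProbabilityMeasure μ]
          (η : Fin n → Ω → ℝ) (ξ : Fin n → Ω → BinaryHMM.E d),
          BinaryHMM.IsSymmetricSignChain μ δ η →
          BinaryHMM.IsIsotropicSubGaussianNoise μ ξ →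
          IndepFun (fun ω i => η i ω) (fun ω i => ξ i ω) μ →
        ∀ (v : ℕ → (Fin n → BinaryHMM.E d) → BinaryHMM.E d), BinaryHMM.IsTopEigenvectorRule v →
          (d < n →
            μ {ω | K * (√(δ * d / n) + d / n) <
                BinaryHMM.loss
                  (BinaryHMM.adaptiveEstimator v C (BinaryHMM.observations θ η ξ ω)) θ ^ 2} ≤
              ENNReal.ofReal (c₁ * Real.log (n / d) * Real.exp (-(c₀ * d)))) ∧
          (n = d →
            μ {ω | K * (√(δ * d / n) + d / n) <
                BinaryHMM.loss
                  (BinaryHMM.adaptiveEstimator v C (BinaryHMM.observations θ η ξ ω)) θ ^ 2} ≤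
              ENNReal.ofReal (c₁ * Real.exp (-(c₀ * d)))) := by
  refine ⟨6812 + 6812 ^ 2, 1 / 2, 10, by norm_num, by norm_num, by norm_num, fun C hC =>
    ⟨BinaryHMM.riskConst C, ?_, ?_⟩⟩
  · have : 0 < C := lt_of_lt_of_le (by norm_num) hC
    unfold BinaryHMM.riskConst
    positivity
  intro n d hd hdn δ hδ0 hδ1 θ hθ Ω _ μ _ η ξ hη hξ hind v hv
  have hmain := BinaryHMM.measure_loss_gt_le hd hdn hδ0.le (by linarith) hC hv hθ hη hξ hind
  refine ⟨fun hlt => hmain.trans (ENNReal.ofReal_le_ofReal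
    (BinaryHMM.two_mul_gridTop_add_three_le hd hlt)), fun heq => ?_⟩
  subst heq
  refine hmain.trans (ENNReal.ofReal_le_ofReal ?_)
  rw [BinaryHMM.gridTop_self n hd]
  have h0 : (0 : ℝ) ≤ n := Nat.cast_nonneg n
  have h1 : Real.exp (-(n : ℝ)) ≤ Real.exp (-(1 / 2 * n)) := Real.exp_le_exp.2 (by linarith)
  have := Real.exp_pos (-(1 / 2 * (n : ℝ)))
  push_cast
  linarith
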